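/- Let $n\ge 2$, let $\Omega\subset\mathbb R^n$ be a bounded open set, and write $|E|$ for the Lebesgue measure of $E$. Lorentz spaces. For an open set $D\subset\mathbb R^n$ of finite measure and a measurable function $u$ on $D$ put $|u|_*(s)=\inf\{t\ge 0: |\{x\in D:|u(x)|>t\}|\le s\}$, $|u|_{**}(t)=\frac1t\int_0^t|u|_*(\sigma)\,d\sigma$, and, for $1\le p<\infty$, $$\|u\|_{L^{p,1}(D)}=\frac1{|D|}\int_0^{|D|}t^{1/p}\,|u|_{**}(t)\,\frac{dt}{t}.$$ $L^{p,1}(D)$ is the set of measurable $u$ for which this is finite (so that $L^{1,1}$ is $L\log L$); $u\in L^{p,1}_{loc}(D)$ means $u\in L^{p,1}(\omega)$ for every open $\omega\subset\subset D$, that is, for every open $\omega$ whose closure is a compact subset of $D$. For a vector field $F$, $\|F\|_{L^{p,1}(D)}$ means $\|\,|F|\,\|_{L^{p,1}(D)}$. Capacity. Let $V:\Omega\to[0,\infty]$ be measurable. For $\psi\in C^2_c(\Omega)$ put $$\|\psi\|_{V,\infty}=\|\psi\|_{L^1(\Omega)}+\Big\|\frac{|\nabla\psi|}{\sqrt V}\Big\|_{L^\infty(\Omega)}+\Big\|\frac{\Delta\psi}{V}\Big\|_{L^\infty(\Omega)}\in[0,\infty]$$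 with the conventions $0/0=0$, $c/0=\infty$ for $c>0$, and $c/\infty=0$ for finite $c$. For a compact $K\subset\Omega$ put $$\mathrm{Cap}_{V,\infty}(K)=\inf\{\|\psi\|_{V,\infty}:\psi\in C^2_c(\Omega),\ 0\le\psi\le1,\ \psi=1\text{ in a neighbourhood of }K\},$$ and $\Omega_K=\{x\in\Omega:\mathrm{dist}(x,K)>0\}$ (with $\Omega_\emptyset=\Omega$). **Theorem.** Let $V$ be as above and let $K\subset\Omega$ be compact with $\mathrm{Cap}_{V,\infty}(K)=0$. Then there is a sequence $(\psi_j)$ in $C^2_c(\Omega)$ such that: 1. $\psi_j=1$ on $K$ for every $j$; $\psi_j\to0$ a.e. in $\Omega$ and in $L^1(\Omega)$; and $|\nabla\psi_j|/\sqrt V\to0$ and $\Delta\psi_j/V\to0$ in $L^\infty(\Omega)$ (these functions being in $L^\infty(\Omega)$ for every $j$). 2. If furthermore $V\in L^{n/2,1}_{loc}(\Omega_K)$, then $\psi_j(x)\to0$ for every $x\in\Omega\setminus K$, and for every open $\omega\subset\subset\Omega_K$ $$\max_{\overline\omega}|\psi_j|\to0\quad\text{and}\quad\|\nabla\psi_j\|_{L^{n,1}(\omega)}\to0.$$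 3. (Independently of $V$ and $K$.) For every $a\in\Omega$ and every $m\in\mathbb R$, the function $x\mapsto|x-a|^{-m}$ belongs to $L^{n/2,1}(\Omega)$ if and only if $m<2$. -/

import Mathlib

open MeasureTheory Set Filter Topology
open scoped ENNReal

noncomputable section

namespace PotentialCapacity

variable {n : ℕ}

/-- The decreasing rearrangement on `D` of a function `u` with values in `[0,∞]`:
`u_*(s) = inf {t : |{x ∈ D : u x > t}| ≤ s}`. -/
def rearrangement (D : Set (EuclideanSpace ℝ (Fin n))) (u : EuclideanSpace ℝ (Fin n) → ℝ≥0∞)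
    (s : ℝ) : ℝ≥0∞ :=
  sInf {t : ℝ≥0∞ | volume {x ∈ D | t < u x} ≤ ENNReal.ofReal s}

/-- The maximal rearrangement `u_**(t) = (1/t) ∫₀ᵗ u_*(σ) dσ`. -/
def maximalRearrangement (D : Set (EuclideanSpace ℝ (Fin n)))
    (u : EuclideanSpace ℝ (Fin n) → ℝ≥0∞) (t : ℝ) : ℝ≥0∞ :=
  (∫⁻ σ in Ioo 0 t, rearrangement D u σ) / ENNReal.ofReal t

/-- The Lorentz norm `[ |D|⁻¹ ∫_{0<t<|D|} (t^{1/p} u_**(t))^q dt/t ]^{1/q}` for finite `p`, `q`.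
(For `q = 1` and `p = 1` this is a norm of `L log L`, not of `L¹`.) -/
def lorentzNorm (p q : ℝ) (D : Set (EuclideanSpace ℝ (Fin n)))
    (u : EuclideanSpace ℝ (Fin n) → ℝ≥0∞) : ℝ≥0∞ :=
  ((volume D)⁻¹ * ∫⁻ t in {t : ℝ | 0 < t ∧ ENNReal.ofReal t < volume D},
    (ENNReal.ofReal t ^ (1 / p) * maximalRearrangement D u t) ^ q / ENNReal.ofReal t) ^ (1 / q)

/-- Membership in the Lorentz space `L^{p,q}(D)`. -/
def MemLorentz (p q : ℝ) (D : Set (EuclideanSpace ℝ (Fin n)))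
    (u : EuclideanSpace ℝ (Fin n) → ℝ≥0∞) : Prop :=
  AEMeasurable u (volume.restrict D) ∧ lorentzNorm p q D u < ∞

/-- `ω ⊂⊂ D`: `ω` is open and its closure is a compact subset of `D`. -/
def CompactlyContained (ω D : Set (EuclideanSpace ℝ (Fin n))) : Prop :=
  IsOpen ω ∧ IsCompact (closure ω) ∧ closure ω ⊆ D

/-- Membership in `L^{p,q}_loc(D)`. -/
def MemLorentzLoc (p q : ℝ) (D : Set (EuclideanSpace ℝ (Fin n)))
    (u : EuclideanSpace ℝ (Fin n) → ℝ≥0∞) : Prop :=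
  ∀ ω, CompactlyContained ω D → MemLorentz p q ω u

/-- The space `C²_c(Ω)` (functions extended by zero outside `Ω`). -/
def C2c (Ω : Set (EuclideanSpace ℝ (Fin n))) : Set (EuclideanSpace ℝ (Fin n) → ℝ) :=
  {ψ | ContDiff ℝ 2 ψ ∧ HasCompactSupport ψ ∧ tsupport ψ ⊆ Ω}

/-- The `ψ ∈ C²_c(Ω)` with `0 ≤ ψ ≤ 1` and `ψ = 1` in a neighbourhood of `K`. -/
def B2 (Ω K : Set (EuclideanSpace ℝ (Fin n))) : Set (EuclideanSpace ℝ (Fin n) → ℝ) :=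
  {ψ | ψ ∈ C2c Ω ∧ (∀ x, 0 ≤ ψ x ∧ ψ x ≤ 1) ∧ ∀ᶠ x in 𝓝ˢ K, ψ x = 1}

/-- `‖ |∇ψ| / √V ‖_{L^∞(Ω)}`; division in `[0,∞]`, so `0/0 = 0`, `c/0 = ∞` for `c > 0` and
`c/∞ = 0` for finite `c`. -/
def gradRatioNorm (Ω : Set (EuclideanSpace ℝ (Fin n))) (V : EuclideanSpace ℝ (Fin n) → ℝ≥0∞)
    (ψ : EuclideanSpace ℝ (Fin n) → ℝ) : ℝ≥0∞ :=
  essSup (fun x => ‖gradient ψ x‖ₑ / V x ^ (1 / 2 : ℝ)) (volume.restrict Ω)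

/-- `‖ Δψ / V ‖_{L^∞(Ω)}`, with the same conventions. -/
def laplaceRatioNorm (Ω : Set (EuclideanSpace ℝ (Fin n))) (V : EuclideanSpace ℝ (Fin n) → ℝ≥0∞)
    (ψ : EuclideanSpace ℝ (Fin n) → ℝ) : ℝ≥0∞ :=
  essSup (fun x => ‖Laplacian.laplacian ψ x‖ₑ / V x) (volume.restrict Ω)

/-- `‖ψ‖_{V,∞}`. -/
def potentialNorm (Ω : Set (EuclideanSpace ℝ (Fin n))) (V : EuclideanSpace ℝ (Fin n) → ℝ≥0∞)
    (ψ : EuclideanSpace ℝ (Fin n) → ℝ) : ℝ≥0∞ :=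
  eLpNorm ψ 1 (volume.restrict Ω) + gradRatioNorm Ω V ψ + laplaceRatioNorm Ω V ψ

/-- The potential-capacity `Cap_{V,∞}(K)` of `K` in `Ω`. -/
def capacity (Ω : Set (EuclideanSpace ℝ (Fin n))) (V : EuclideanSpace ℝ (Fin n) → ℝ≥0∞)
    (K : Set (EuclideanSpace ℝ (Fin n))) : ℝ≥0∞ :=
  ⨅ ψ ∈ B2 Ω K, potentialNorm Ω V ψ

/-- `Ω_K = {x ∈ Ω : dist(x, K) > 0}` (with `dist(x, ∅) = ∞`). -/
def awayFrom (Ω K : Set (EuclideanSpace ℝ (Fin n))) : Set (EuclideanSpace ℝ (Fin n)) :=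
  {x ∈ Ω | 0 < Metric.infEDist x K}

end PotentialCapacity

end

/-! Zero capacity gives admissible `ψ_j` with norm tending to `0`; the `L¹` part of the norm gives a
subsequence converging a.e., which is all of the first claim. The same subsequence serves the second
claim, because everything there is bounded by the norm alone, through an interior estimate.

Let `u = φ ψ` with `φ` a cutoff equal to `1` near `closure ω` and supported in `ω'`. If `|∇ψ| ≤ ε
√V` and `|Δψ| ≤ ε V`, the product rule and `√V ≤ V + 1` give `|Δu| ≤ M (2 ε (V + 1) + |ψ|)` on `ω'`.
Two pointwise inequalities, `|∇u| ≤ C I(|Δu|)` and `|u| ≤ C I(|∇u|)`, where `I` is convolution with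
`|z|^{1-n}`, reduce the estimate to three properties of `I`: it maps `L^{n/2,1}` to `L^{n,1}`
(`lorentzIntegral_rieszPotential_le`), it maps `L^{n,1}` to `L^∞`
(`rieszPotential_le_lorentzIntegral`), and it is small on functions with values in `[0,1]` and small
`L¹` norm (`rieszPotential_le_of_le_one`). The last one absorbs the term `|ψ|`, which `V` does not
control. The first application of `I` yields the gradient bound, the second the uniform bound
(`exists_interior_estimate`).

Both Lorentz bounds are proved level by level: for second index `1` the functional is an integral
over levels of a function of the measure of the superlevel set. This covers `n = 2`, where `L^{1,1}`
is `L log L`, without a separate argument.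

The two representation inequalities come from the smooth field `z (|z|² + δ²)^{-n/2}`: it is
curl-free, dominated by `|z|^{1-n}`, and its divergence tends to a multiple of the Dirac mass as `δ
→ 0`.

For the power functions, the rearrangement of `|x - a|^{-m}` is comparable to `s^{-m/n}` near `s =
0`, so membership is decided by integrability of `t^{(2-m)/n - 1}` at `0`. -/

noncomputable section

namespace PotentialCapacity

variable {n : ℕ}

/-! ### Layer-cake formulas. -/

/-- Every extended nonnegative number is the length of its sublevel ray. -/
theorem lintegral_indicator_ofReal_lt (x : ℝ≥0∞) :
    ∫⁻ l in Ioi (0 : ℝ), {l : ℝ | ENNReal.ofReal l < x}.indicator (fun _ => (1 : ℝ≥0∞)) l = x := by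
  have hm : MeasurableSet {l : ℝ | ENNReal.ofReal l < x} :=
    measurableSet_lt ENNReal.measurable_ofReal measurable_const
  rw [lintegral_indicator_const hm, one_mul, Measure.restrict_apply hm]
  induction x with
  | top => simp
  | coe x =>
    have : {l : ℝ | ENNReal.ofReal l < (x : ℝ≥0∞)} ∩ Ioi 0 = Ioo 0 (x : ℝ) := by
      ext l
      simp only [mem_inter_iff, mem_ofPred_eq, mem_Ioi, mem_Ioo]
      constructor
      · rintro ⟨h, h0⟩
        refine ⟨h0, ?_⟩
        rw [← ENNReal.ofReal_coe_nnreal] at h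
        exact (ENNReal.ofReal_lt_ofReal_iff_of_nonneg h0.le).1 h
      · rintro ⟨h0, h⟩
        refine ⟨?_, h0⟩
        rw [← ENNReal.ofReal_coe_nnreal]
        exact (ENNReal.ofReal_lt_ofReal_iff_of_nonneg h0.le).2 h
    rw [this]; simp

/-- Layer-cake formula against a weight, over an arbitrary set of levels. -/
theorem lintegral_layer_mul {α : Type*} [MeasurableSpace α] {μ : Measure α}
    [SFinite μ] {f w : α → ℝ≥0∞} (hf : Measurable f) (hw : Measurable w) (S : Set ℝ) :
    ∫⁻ a, (∫⁻ l in S, {l : ℝ | ENNReal.ofReal l < f a}.indicator (fun _ => 1) l) * w a ∂μ =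
      ∫⁻ l in S, ∫⁻ a in {a | ENNReal.ofReal l < f a}, w a ∂μ := by
  have hS : MeasurableSet {p : α × ℝ | ENNReal.ofReal p.2 < f p.1} :=
    measurableSet_lt (ENNReal.measurable_ofReal.comp measurable_snd) (hf.comp measurable_fst)
  calc _ = ∫⁻ a, (∫⁻ l in S,
          {p : α × ℝ | ENNReal.ofReal p.2 < f p.1}.indicator (fun p => w p.1) (a, l)) ∂μ := by
        refine lintegral_congr fun a => ?_
        rw [← lintegral_mul_const]
        · refine lintegral_congr fun l => ?_
          by_cases h : ENNReal.ofReal l < f a <;> simp [indicator, h]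
        · exact measurable_const.indicator
            (measurableSet_lt ENNReal.measurable_ofReal measurable_const)
    _ = ∫⁻ l in S, ∫⁻ a,
          {p : α × ℝ | ENNReal.ofReal p.2 < f p.1}.indicator (fun p => w p.1) (a, l) ∂μ := by
        refine lintegral_lintegral_swap ?_
        exact ((hw.comp measurable_fst).indicator hS).aemeasurable
    _ = _ := by
        refine lintegral_congr fun l => ?_
        rw [← lintegral_indicator (measurableSet_lt measurable_const hf)]
        refine lintegral_congr fun a => ?_
        by_cases h : ENNReal.ofReal l < f a <;> simp [indicator, h]

/-- The function assembled from the levels in `S` is measurable. -/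
theorem measurable_layer {α : Type*} [MeasurableSpace α] {f : α → ℝ≥0∞} (hf : Measurable f)
    (S : Set ℝ) :
    Measurable fun a =>
      ∫⁻ l in S, {l : ℝ | ENNReal.ofReal l < f a}.indicator (fun _ => (1 : ℝ≥0∞)) l := by
  have hS : MeasurableSet {p : α × ℝ | ENNReal.ofReal p.2 < f p.1} :=
    measurableSet_lt (ENNReal.measurable_ofReal.comp measurable_snd) (hf.comp measurable_fst)
  exact Measurable.lintegral_prod_right'
    (f := {p : α × ℝ | ENNReal.ofReal p.2 < f p.1}.indicator (fun _ => (1 : ℝ≥0∞)))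
    (measurable_const.indicator hS)

/-- Layer-cake formula against a weight. -/
theorem lintegral_mul_eq_lintegral_superlevel {α : Type*} [MeasurableSpace α] {μ : Measure α}
    [SFinite μ] {f w : α → ℝ≥0∞} (hf : Measurable f) (hw : Measurable w) :
    ∫⁻ a, f a * w a ∂μ =
      ∫⁻ l in Ioi (0 : ℝ), ∫⁻ a in {a | ENNReal.ofReal l < f a}, w a ∂μ := by
  simpa only [lintegral_indicator_ofReal_lt] using lintegral_layer_mul (μ := μ) hf hw (Ioi 0)

theorem lintegral_eq_lintegral_superlevel {α : Type*} [MeasurableSpace α] {μ : Measure α}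
    [SFinite μ] {f : α → ℝ≥0∞} (hf : Measurable f) :
    ∫⁻ a, f a ∂μ = ∫⁻ l in Ioi (0 : ℝ), μ {a | ENNReal.ofReal l < f a} := by
  simpa using lintegral_mul_eq_lintegral_superlevel (μ := μ) hf (measurable_const (a := 1))

/-! ### Distribution functions and decreasing rearrangements. -/

section Rearrangement

variable {D D' : Set (EuclideanSpace ℝ (Fin n))} {u v : EuclideanSpace ℝ (Fin n) → ℝ≥0∞}

/-- The distribution function of `u` on `D`. -/
def distribution (D : Set (EuclideanSpace ℝ (Fin n))) (u : EuclideanSpace ℝ (Fin n) → ℝ≥0∞)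
    (l : ℝ≥0∞) : ℝ≥0∞ :=
  volume {x ∈ D | l < u x}

theorem distribution_antitone : Antitone (distribution D u) := fun _ _ h =>
  measure_mono fun _ hx => ⟨hx.1, h.trans_lt hx.2⟩

theorem distribution_le_measure (l : ℝ≥0∞) : distribution D u l ≤ volume D :=
  measure_mono fun _ hx => hx.1

/-- The infimum is attained because the distribution function is right-continuous, by continuity of
the measure along increasing unions. This Galois-type equivalence replaces the definition from here
on; it needs no measurability of `u`. -/
theorem rearrangement_le_iff {s : ℝ} {l : ℝ≥0∞} :
    rearrangement D u s ≤ l ↔ distribution D u l ≤ ENNReal.ofReal s := by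
  constructor
  · intro h
    have key : ∀ t, l < t → distribution D u t ≤ ENNReal.ofReal s := by
      intro t ht
      obtain ⟨r, hr, hrt⟩ := sInf_lt_iff.1 (h.trans_lt ht)
      exact (distribution_antitone hrt.le).trans hr
    rcases eq_or_ne l ∞ with rfl | hl
    · simp [distribution]
    obtain ⟨t, ht_anti, ht_gt, ht_lim⟩ := exists_seq_strictAnti_tendsto' (lt_top_iff_ne_top.2 hl)
    have hU : {x ∈ D | l < u x} = ⋃ k, {x ∈ D | t k < u x} := by
      ext x
      simp only [mem_ofPred_eq, mem_iUnion, exists_and_left]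
      refine and_congr_right fun _ => ⟨fun hx => ?_, fun ⟨k, hk⟩ => (ht_gt k).1.trans hk⟩
      exact (ht_lim.eventually_lt_const hx).exists
    have hmono : Monotone fun k => {x ∈ D | t k < u x} := fun i j hij x hx =>
      ⟨hx.1, (ht_anti.antitone hij).trans_lt hx.2⟩
    rw [distribution, hU, hmono.measure_iUnion]
    exact iSup_le fun k => key _ (ht_gt k).1
  · intro h
    exact sInf_le h

theorem lt_rearrangement_iff {s : ℝ} {l : ℝ≥0∞} :
    l < rearrangement D u s ↔ ENNReal.ofReal s < distribution D u l := by
  rw [← not_le, rearrangement_le_iff, not_le]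

theorem rearrangement_antitone : Antitone (rearrangement D u) := fun _ _ h =>
  sInf_le_sInf fun _ ht => le_trans ht (ENNReal.ofReal_le_ofReal h)

theorem volume_Ioo_inter_ofReal_lt (t : ℝ) (m : ℝ≥0∞) :
    volume ({s : ℝ | ENNReal.ofReal s < m} ∩ Ioo 0 t) = min (ENNReal.ofReal t) m := by
  rcases le_or_gt t 0 with ht | ht
  · simp [Ioo_eq_empty_of_le ht, ENNReal.ofReal_of_nonpos ht]
  rcases le_or_gt (ENNReal.ofReal t) m with h | h
  · rw [min_eq_left h]
    have : {s : ℝ | ENNReal.ofReal s < m} ∩ Ioo 0 t = Ioo 0 t := by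
      refine inter_eq_right.2 fun s hs => ?_
      exact ((ENNReal.ofReal_lt_ofReal_iff ht).2 hs.2).trans_le h
    rw [this]; simp
  · rw [min_eq_right h.le]
    lift m to NNReal using h.ne_top
    rw [← ENNReal.ofReal_coe_nnreal] at h ⊢
    have hm : (m : ℝ) < t := (ENNReal.ofReal_lt_ofReal_iff ht).1 h
    have : {s : ℝ | ENNReal.ofReal s < ENNReal.ofReal m} ∩ Ioo 0 t = Ioo 0 (m : ℝ) := by
      ext s
      simp only [mem_inter_iff, mem_ofPred_eq, mem_Ioo]
      constructor
      · rintro ⟨h1, h2, h3⟩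
        exact ⟨h2, (ENNReal.ofReal_lt_ofReal_iff_of_nonneg h2.le).1 h1⟩
      · rintro ⟨h1, h2⟩
        exact ⟨(ENNReal.ofReal_lt_ofReal_iff_of_nonneg h1.le).2 h2, h1, h2.trans hm⟩
    rw [this]; simp

/-- The integral of the rearrangement in terms of the distribution function. -/
theorem lintegral_rearrangement (t : ℝ) :
    ∫⁻ s in Ioo 0 t, rearrangement D u s =
      ∫⁻ l in Ioi (0 : ℝ), min (ENNReal.ofReal t) (distribution D u (ENNReal.ofReal l)) := by
  rw [lintegral_eq_lintegral_superlevel rearrangement_antitone.measurable]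
  refine lintegral_congr fun l => ?_
  have hm : MeasurableSet {s | ENNReal.ofReal l < rearrangement D u s} :=
    measurableSet_lt measurable_const rearrangement_antitone.measurable
  rw [Measure.restrict_apply hm, ← volume_Ioo_inter_ofReal_lt]
  simp_rw [lt_rearrangement_iff]

theorem rearrangement_mono_of_ae (hDD : D ⊆ D') (h : ∀ᵐ x ∂volume, x ∈ D → u x ≤ v x) (s : ℝ) :
    rearrangement D u s ≤ rearrangement D' v s := by
  refine sInf_le_sInf fun l hl => le_trans (measure_mono_ae ?_) hl
  filter_upwards [h] with x hx hxD
  exact ⟨hDD hxD.1, hxD.2.trans_le (hx hxD.1)⟩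

theorem rearrangement_add_const_le (c : ℝ≥0∞) (s : ℝ) :
    rearrangement D (fun x => u x + c) s ≤ rearrangement D u s + c := by
  rw [rearrangement_le_iff]
  refine le_trans (measure_mono ?_) (rearrangement_le_iff.1 (le_refl (rearrangement D u s)))
  intro x hx
  exact ⟨hx.1, lt_of_add_lt_add_right hx.2⟩

theorem rearrangement_const_mul {c : ℝ≥0∞} (hc : c ≠ 0) (hc' : c ≠ ∞) (s : ℝ) :
    rearrangement D (fun x => c * u x) s = c * rearrangement D u s := by
  refine eq_of_forall_ge_iff fun l => ?_
  rw [mul_comm c (rearrangement D u s), ← ENNReal.le_div_iff_mul_le (.inl hc) (.inl hc'),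
    rearrangement_le_iff, rearrangement_le_iff]
  have : {x ∈ D | l < c * u x} = {x ∈ D | l / c < u x} := by
    ext x
    simp only [mem_ofPred_eq]
    rw [ENNReal.div_lt_iff (.inl hc) (.inl hc'), mul_comm]
  rw [distribution, this, distribution]

/-- If `u ≤ a + c` on `D`, then `∫₀ᵗ u_* ≤ ∫_D a + t c`. -/
theorem lintegral_rearrangement_le {a : EuclideanSpace ℝ (Fin n) → ℝ≥0∞} (ha : Measurable a)
    (c : ℝ≥0∞) (h : ∀ x ∈ D, u x ≤ a x + c) (t : ℝ) :
    ∫⁻ s in Ioo 0 t, rearrangement D u s ≤ (∫⁻ x in D, a x) + ENNReal.ofReal t * c := by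
  calc ∫⁻ s in Ioo 0 t, rearrangement D u s
      ≤ ∫⁻ s in Ioo 0 t, (rearrangement D a s + c) := by
        refine lintegral_mono fun s => ?_
        refine (rearrangement_mono_of_ae subset_rfl ?_ s).trans (rearrangement_add_const_le c s)
        exact Eventually.of_forall h
    _ = (∫⁻ s in Ioo 0 t, rearrangement D a s) + ENNReal.ofReal t * c := by
        rw [lintegral_add_right _ measurable_const]
        simp [mul_comm]
    _ ≤ _ := by
        gcongr
        rw [lintegral_rearrangement, lintegral_eq_lintegral_superlevel ha]
        refine lintegral_mono fun l => (min_le_right _ _).trans ?_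
        rw [Measure.restrict_apply (measurableSet_lt measurable_const ha), distribution]
        exact measure_mono fun x hx => ⟨hx.2, hx.1⟩

end Rearrangement

/-! ### The Riesz potential of order one and its rearrangement. -/

/-- The kernel `|z|^{1-n}` of the Riesz potential of order one. -/
def rieszKernel (z : EuclideanSpace ℝ (Fin n)) : ℝ≥0∞ :=
  ENNReal.ofReal (‖z‖ ^ (1 - (n : ℝ)))

theorem measurable_rieszKernel : Measurable (rieszKernel (n := n)) := by
  unfold rieszKernel
  fun_prop

/-- The integral of `|z|^{1-n}` over the unit ball. -/
def rieszMass (n : ℕ) : ℝ :=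
  ∫ z in Metric.ball (0 : EuclideanSpace ℝ (Fin n)) 1, ‖z‖ ^ (1 - (n : ℝ))

theorem rieszMass_nonneg : 0 ≤ rieszMass n :=
  integral_nonneg fun _ => by positivity

/-- Scaling to the unit ball: the Jacobian contributes `r^n` and the homogeneity of the kernel
`r^{1-n}`. -/
theorem lintegral_ball_rieszKernel (hn : 2 ≤ n) {r : ℝ} (hr : 0 < r) :
    ∫⁻ z in Metric.ball (0 : EuclideanSpace ℝ (Fin n)) r, rieszKernel z =
      ENNReal.ofReal (r * rieszMass n) := by
  have hint : IntegrableOn (fun z : EuclideanSpace ℝ (Fin n) => ‖z‖ ^ (1 - (n : ℝ)))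
      (Metric.ball 0 r) := by
    refine integrableOn_ball_of_norm_le_rpow (C := 1) (α := (n : ℝ) - 1) ?_ ?_ ?_ ?_
    · rw [finrank_euclideanSpace_fin]; lia
    · rw [finrank_euclideanSpace_fin]; linarith
    · refine Eventually.of_forall fun z => ?_
      rw [one_mul, Real.norm_of_nonneg (by positivity), neg_sub]
    · exact (by fun_prop : Measurable fun z : EuclideanSpace ℝ (Fin n) =>
        ‖z‖ ^ (1 - (n : ℝ))).aestronglyMeasurable
  unfold rieszKernel
  rw [← ofReal_integral_eq_lintegral_ofReal hint (Eventually.of_forall fun _ => by positivity)]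
  congr 1
  have h := Measure.setIntegral_comp_smul_of_pos volume
    (fun z : EuclideanSpace ℝ (Fin n) => ‖z‖ ^ (1 - (n : ℝ))) (Metric.ball 0 1) hr
  rw [smul_unitBall hr.ne', Real.norm_of_nonneg hr.le, finrank_euclideanSpace_fin] at h
  simp_rw [norm_smul, Real.norm_of_nonneg hr.le, Real.mul_rpow hr.le (norm_nonneg _)] at h
  rw [integral_const_mul, smul_eq_mul, eq_inv_mul_iff_mul_eq₀ (by positivity)] at h
  rw [← h, ← mul_assoc, rieszMass]
  congr 1
  rw [← Real.rpow_natCast, ← Real.rpow_add hr]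
  simp

/-- The part of the kernel near the origin. -/
def nearKernel (r : ℝ) : EuclideanSpace ℝ (Fin n) → ℝ≥0∞ :=
  (Metric.ball 0 r).indicator rieszKernel

theorem measurable_nearKernel (r : ℝ) : Measurable (nearKernel (n := n) r) :=
  measurable_rieszKernel.indicator measurableSet_ball

theorem lintegral_nearKernel (hn : 2 ≤ n) {r : ℝ} (hr : 0 < r) :
    ∫⁻ z, nearKernel (n := n) r z = ENNReal.ofReal (r * rieszMass n) := by
  rw [nearKernel, lintegral_indicator measurableSet_ball, lintegral_ball_rieszKernel hn hr]

/-- Splits the kernel into an integrable part of mass proportional to `r` and a bounded part. Every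
estimate of the potential below is this splitting with a suitable `r`. -/
theorem rieszKernel_le (hn : 2 ≤ n) {r : ℝ} (hr : 0 < r) (z : EuclideanSpace ℝ (Fin n)) :
    rieszKernel z ≤ nearKernel r z + ENNReal.ofReal (r ^ (1 - (n : ℝ))) := by
  by_cases h : z ∈ Metric.ball 0 r
  · rw [nearKernel, indicator_of_mem h]
    exact le_self_add
  · refine le_add_left (ENNReal.ofReal_le_ofReal ?_)
    have hz : r ≤ ‖z‖ := by simpa using h
    have : (2 : ℝ) ≤ n := by exact_mod_cast hn
    exact Real.rpow_le_rpow_of_nonpos hr hz (by linarith)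

theorem setLIntegral_rieszKernel_le_near (hn : 2 ≤ n) {r : ℝ} (hr : 0 < r)
    (G : Set (EuclideanSpace ℝ (Fin n))) (x : EuclideanSpace ℝ (Fin n)) :
    ∫⁻ y in G, rieszKernel (x - y) ≤
      (∫⁻ y in G, nearKernel r (x - y)) + volume G * ENNReal.ofReal (r ^ (1 - (n : ℝ))) := by
  refine (lintegral_mono fun y => rieszKernel_le hn hr (x - y)).trans ?_
  rw [lintegral_add_right _ measurable_const, setLIntegral_const, mul_comm]

theorem lintegral_nearKernel_sub_left (hn : 2 ≤ n) {r : ℝ} (hr : 0 < r)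
    (x : EuclideanSpace ℝ (Fin n)) :
    ∫⁻ y, nearKernel r (x - y) = ENNReal.ofReal (r * rieszMass n) := by
  rw [lintegral_sub_left_eq_self (nearKernel r) x, lintegral_nearKernel hn hr]

theorem lintegral_nearKernel_sub_right (hn : 2 ≤ n) {r : ℝ} (hr : 0 < r)
    (y : EuclideanSpace ℝ (Fin n)) :
    ∫⁻ x, nearKernel r (x - y) = ENNReal.ofReal (r * rieszMass n) := by
  rw [lintegral_sub_right_eq_self (nearKernel r) y, lintegral_nearKernel hn hr]

/-- Among sets of given measure the potential of an indicator is bounded. -/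
theorem setLIntegral_rieszKernel_le (hn : 2 ≤ n) (G : Set (EuclideanSpace ℝ (Fin n)))
    (hG : volume G ≠ ∞) (x : EuclideanSpace ℝ (Fin n)) :
    ∫⁻ y in G, rieszKernel (x - y) ≤
      ENNReal.ofReal (rieszMass n + 1) * volume G ^ (1 / (n : ℝ)) := by
  have hn' : (2 : ℝ) ≤ n := by exact_mod_cast hn
  rcases eq_or_ne (volume G) 0 with h0 | h0
  · rw [setLIntegral_measure_zero _ _ h0]; exact zero_le
  set s := (volume G).toReal with hs
  have hs0 : 0 < s := ENNReal.toReal_pos h0 hG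
  have hGs : volume G = ENNReal.ofReal s := (ENNReal.ofReal_toReal hG).symm
  -- The radius `|G|^{1/n}` balances the near part, of order `r`, against the far part `|G|
  -- r^{1-n}`.
  have hr : 0 < s ^ (1 / (n : ℝ)) := by positivity
  refine (setLIntegral_rieszKernel_le_near hn hr G x).trans ?_
  calc _ ≤ ENNReal.ofReal (s ^ (1 / (n : ℝ)) * rieszMass n) +
        ENNReal.ofReal s * ENNReal.ofReal ((s ^ (1 / (n : ℝ))) ^ (1 - (n : ℝ))) := by
        rw [hGs]
        gcongr
        exact (setLIntegral_le_lintegral _ _).trans (lintegral_nearKernel_sub_left hn hr x).le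
    _ = _ := by
        rw [hGs, ENNReal.ofReal_rpow_of_pos hs0, ← ENNReal.ofReal_mul hs0.le,
          ← ENNReal.ofReal_add (mul_nonneg hr.le rieszMass_nonneg) (by positivity),
          ← ENNReal.ofReal_mul (add_nonneg rieszMass_nonneg zero_le_one)]
        congr 1
        have : s * (s ^ (1 / (n : ℝ))) ^ (1 - (n : ℝ)) = s ^ (1 / (n : ℝ)) := by
          rw [← Real.rpow_mul hs0.le]
          nth_rewrite 1 [← Real.rpow_one s]
          rw [← Real.rpow_add hs0]
          congr 1
          field_simp
          ring
        rw [this]; ring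

/-- The Riesz potential of order one, up to normalisation. -/
def rieszPotential (g : EuclideanSpace ℝ (Fin n) → ℝ≥0∞) (x : EuclideanSpace ℝ (Fin n)) : ℝ≥0∞ :=
  ∫⁻ y, g y * rieszKernel (x - y)

theorem measurable_rieszPotential {g : EuclideanSpace ℝ (Fin n) → ℝ≥0∞} (hg : Measurable g) :
    Measurable (rieszPotential g) :=
  Measurable.lintegral_prod_right'
    (f := fun p : EuclideanSpace ℝ (Fin n) × EuclideanSpace ℝ (Fin n) =>
      g p.2 * rieszKernel (p.1 - p.2))
    ((hg.comp measurable_snd).mul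
      (measurable_rieszKernel.comp (measurable_fst.sub measurable_snd)))

theorem distribution_indicator {D : Set (EuclideanSpace ℝ (Fin n))}
    {g : EuclideanSpace ℝ (Fin n) → ℝ≥0∞} (l : ℝ≥0∞) :
    {y | l < D.indicator g y} = {y ∈ D | l < g y} := by
  ext y
  by_cases h : y ∈ D <;> simp [h]

/-- Dependence on `t` and on the measure of a set of the integrated rearrangement of the potential
of its indicator. -/
def layerBound (n : ℕ) (t : ℝ) (m : ℝ≥0∞) : ℝ≥0∞ :=
  if m ≤ ENNReal.ofReal t then m * ENNReal.ofReal (t ^ (1 / (n : ℝ)))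
  else ENNReal.ofReal t * m ^ (1 / (n : ℝ))

theorem measurable_layerBound : Measurable fun p : ℝ × ℝ≥0∞ => layerBound n p.1 p.2 := by
  unfold layerBound
  refine Measurable.ite (measurableSet_le measurable_snd (by fun_prop)) (by fun_prop) (by fun_prop)

/-- An inequality of O'Neil type. For a superlevel set of measure `m ≤ t`, the near part of the
kernel is estimated in `L¹` and the far part in `L^∞`; for `m > t` the potential of the indicator is
simply bounded by a multiple of `m^{1/n}`. Integrating over levels adds these bounds. -/
theorem lintegral_rearrangement_rieszPotential_le (hn : 2 ≤ n)
    {D D' : Set (EuclideanSpace ℝ (Fin n))} (hD : MeasurableSet D) (hDf : volume D ≠ ∞)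
    {g : EuclideanSpace ℝ (Fin n) → ℝ≥0∞} (hg : Measurable g) {t : ℝ} (ht : 0 < t) :
    ∫⁻ s in Ioo 0 t, rearrangement D' (rieszPotential (D.indicator g)) s ≤
      ENNReal.ofReal (rieszMass n + 1) *
        ∫⁻ l in Ioi (0 : ℝ), layerBound n t (distribution D g (ENNReal.ofReal l)) := by
  have hn' : (2 : ℝ) ≤ n := by exact_mod_cast hn
  have hgD : Measurable (D.indicator g) := hg.indicator hD
  -- With this radius `t r^{1-n} = r`, so the near and far contributions of small superlevel sets
  -- coincide up to a constant.
  set r := t ^ (1 / (n : ℝ)) with hr_def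
  have hr : 0 < r := by positivity
  set m : ℝ → ℝ≥0∞ := fun l => distribution D g (ENNReal.ofReal l) with hm_def
  have hm : Measurable m :=
    distribution_antitone.measurable.comp ENNReal.measurable_ofReal
  have hmf : ∀ l, m l ≠ ∞ := fun l => ((distribution_le_measure _).trans_lt hDf.lt_top).ne
  set A : Set ℝ := {l | m l ≤ ENNReal.ofReal t} with hA_def
  have hA : MeasurableSet A := measurableSet_le hm measurable_const
  -- The part of `g` above the height `g_*(t)`, that is `(g - g_*(t))⁺` on `D`. Only its near
  -- potential is unbounded; all other contributions go into the constant `β`.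
  set h : EuclideanSpace ℝ (Fin n) → ℝ≥0∞ := fun y => ∫⁻ l in Ioi 0 ∩ A,
    {l : ℝ | ENNReal.ofReal l < D.indicator g y}.indicator (fun _ => 1) l with hh_def
  have hh : Measurable h := measurable_layer hgD _
  set β : ℝ≥0∞ := (∫⁻ l in Ioi 0 ∩ A, m l * ENNReal.ofReal (r ^ (1 - (n : ℝ)))) +
    ∫⁻ l in Ioi 0 \ A, ENNReal.ofReal (rieszMass n + 1) * m l ^ (1 / (n : ℝ)) with hβ
  have hmeas2 : Measurable fun p : EuclideanSpace ℝ (Fin n) × EuclideanSpace ℝ (Fin n) =>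
      h p.2 * nearKernel r (p.1 - p.2) :=
    (hh.comp measurable_snd).mul
      ((measurable_nearKernel r).comp (measurable_fst.sub measurable_snd))
  have hbound : ∀ x ∈ D', rieszPotential (D.indicator g) x ≤
      (∫⁻ y, h y * nearKernel r (x - y)) + β := by
    intro x _
    have hK : Measurable fun y => rieszKernel (x - y) :=
      measurable_rieszKernel.comp (measurable_const.sub measurable_id)
    have hN : Measurable fun y => nearKernel r (x - y) :=
      (measurable_nearKernel r).comp (measurable_const.sub measurable_id)
    rw [rieszPotential, lintegral_mul_eq_lintegral_superlevel hgD hK,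
      lintegral_layer_mul hgD hN, ← lintegral_inter_add_sdiff _ (Ioi 0) hA, hβ, ← add_assoc]
    simp_rw [distribution_indicator]
    gcongr with l
    · rw [← lintegral_add_right _ (hm.mul_const _)]
      exact lintegral_mono fun l => setLIntegral_rieszKernel_le_near hn hr _ x
    · exact setLIntegral_rieszKernel_le hn _ (hmf l) x
  have hL1 : ∫⁻ x, ∫⁻ y, h y * nearKernel r (x - y) =
      ∫⁻ l in Ioi 0 ∩ A, m l * ENNReal.ofReal (r * rieszMass n) := by
    rw [lintegral_lintegral_swap hmeas2.aemeasurable]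
    have : ∀ y, ∫⁻ x, h y * nearKernel r (x - y) = h y * ENNReal.ofReal (r * rieszMass n) := by
      intro y
      have hN : Measurable fun x => nearKernel r (x - y) :=
        (measurable_nearKernel r).comp (measurable_id.sub measurable_const)
      rw [lintegral_const_mul _ hN, lintegral_nearKernel_sub_right hn hr]
    simp_rw [this]
    rw [lintegral_layer_mul hgD measurable_const]
    simp_rw [distribution_indicator, setLIntegral_const, mul_comm (ENNReal.ofReal _) (volume _)]
    rfl
  refine (lintegral_rearrangement_le hmeas2.lintegral_prod_right' β hbound t).trans ?_
  calc _ ≤ (∫⁻ l in Ioi 0 ∩ A, m l * ENNReal.ofReal (r * rieszMass n)) +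
        ENNReal.ofReal t * β := by
        gcongr
        exact (setLIntegral_le_lintegral _ _).trans hL1.le
    _ = (∫⁻ l in Ioi 0 ∩ A, ENNReal.ofReal (rieszMass n + 1) * layerBound n t (m l)) +
        ∫⁻ l in Ioi 0 \ A, ENNReal.ofReal (rieszMass n + 1) * layerBound n t (m l) := by
        have hIA : MeasurableSet (Ioi 0 ∩ A) := measurableSet_Ioi.inter hA
        have hIA' : MeasurableSet (Ioi 0 \ A) := measurableSet_Ioi.diff hA
        rw [hβ, mul_add, ← add_assoc]
        congr 1
        · rw [← lintegral_const_mul _ (hm.mul_const _),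
            ← lintegral_add_left (hm.mul_const _)]
          refine setLIntegral_congr_fun hIA fun l hl => ?_
          have hl' : m l ≤ ENNReal.ofReal t := hl.2
          simp only [layerBound, if_pos hl']
          have h1 : t * r ^ (1 - (n : ℝ)) = r := by
            rw [hr_def, ← Real.rpow_mul ht.le]
            nth_rewrite 1 [← Real.rpow_one t]
            rw [← Real.rpow_add ht]
            congr 1
            field_simp
            ring
          rw [mul_left_comm (ENNReal.ofReal t), ← ENNReal.ofReal_mul ht.le, h1, ← mul_add,
            ← ENNReal.ofReal_add (mul_nonneg hr.le rieszMass_nonneg) hr.le,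
            mul_left_comm, ← ENNReal.ofReal_mul (add_nonneg rieszMass_nonneg zero_le_one)]
          congr 2
          ring
        · rw [← lintegral_const_mul _ ((hm.pow_const _).const_mul _)]
          refine setLIntegral_congr_fun hIA' fun l hl => ?_
          have hl' : ¬ m l ≤ ENNReal.ofReal t := hl.2
          simp only [layerBound, if_neg hl']
          ring
    _ = _ := by
        rw [lintegral_inter_add_sdiff _ _ hA, lintegral_const_mul]
        exact measurable_layerBound.comp (measurable_const.prodMk hm)

theorem lintegral_Ioo_rpow {a s : ℝ} (ha : 0 < a) (hs : 0 ≤ s) :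
    ∫⁻ t in Ioo 0 s, ENNReal.ofReal (t ^ (a - 1)) = ENNReal.ofReal (s ^ a / a) := by
  rw [setLIntegral_congr Ioo_ae_eq_Ioc]
  have hint : IntervalIntegrable (fun t : ℝ => t ^ (a - 1)) volume 0 s :=
    intervalIntegral.intervalIntegrable_rpow' (by linarith)
  rw [← ofReal_integral_eq_lintegral_ofReal ((intervalIntegrable_iff_integrableOn_Ioc_of_le hs).1
    hint), ← intervalIntegral.integral_of_le hs, integral_rpow (.inl (by linarith))]
  · simp [Real.zero_rpow ha.ne']
  · exact (ae_restrict_mem measurableSet_Ioc).mono fun t ht => Real.rpow_nonneg ht.1.le _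

/-! ### Lorentz functionals and the mapping properties of the potential. -/

section Lorentz

variable {D D' : Set (EuclideanSpace ℝ (Fin n))} {u v : EuclideanSpace ℝ (Fin n) → ℝ≥0∞} {p : ℝ}

/-- The unnormalised Lorentz functional `∫₀ᵀ t^{1/p-2} ∫₀ᵗ u_*`, with `T = |D|`. -/
def lorentzIntegral (p : ℝ) (D : Set (EuclideanSpace ℝ (Fin n)))
    (u : EuclideanSpace ℝ (Fin n) → ℝ≥0∞) : ℝ≥0∞ :=
  ∫⁻ t in Ioo 0 (volume D).toReal,
    ENNReal.ofReal (t ^ (1 / p - 2)) * ∫⁻ s in Ioo 0 t, rearrangement D u s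

theorem lorentzNorm_one_eq (hD : volume D ≠ ∞) :
    lorentzNorm p 1 D u = (volume D)⁻¹ * lorentzIntegral p D u := by
  have hset : {t : ℝ | 0 < t ∧ ENNReal.ofReal t < volume D} = Ioo 0 (volume D).toReal := by
    ext t
    simp only [mem_ofPred_eq, mem_Ioo]
    refine and_congr_right fun ht => ?_
    rw [ENNReal.ofReal_lt_iff_lt_toReal ht.le hD]
  simp only [lorentzNorm, lorentzIntegral, ENNReal.rpow_one, div_one]
  rw [hset]
  congr 1
  refine setLIntegral_congr_fun measurableSet_Ioo fun t ht => ?_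
  have ht0 : 0 < t := ht.1
  have h0 : ENNReal.ofReal t ≠ 0 := by simpa using ht0
  simp only [maximalRearrangement, div_eq_mul_inv]
  rw [← ENNReal.ofReal_inv_of_pos ht0, ENNReal.ofReal_rpow_of_pos ht0]
  rw [mul_comm (lintegral _ _), ← mul_assoc, mul_right_comm,
    ← ENNReal.ofReal_mul (by positivity), ← ENNReal.ofReal_mul (by positivity)]
  congr 2
  rw [Real.rpow_sub ht0, mul_assoc, ← mul_inv, div_eq_mul_inv]
  norm_num [sq]

theorem lorentzNorm_one_lt_top_iff (hD : volume D ≠ ∞) :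
    lorentzNorm p 1 D u < ∞ ↔ lorentzIntegral p D u < ∞ := by
  rw [lorentzNorm_one_eq hD]
  rcases eq_or_ne (volume D) 0 with h0 | h0
  · simp [lorentzIntegral, h0]
  · constructor
    · intro h
      by_contra hI
      rw [not_lt_top_iff] at hI
      rw [hI, ENNReal.mul_top (ENNReal.inv_ne_zero.2 hD)] at h
      exact lt_irrefl _ h
    · exact fun h => ENNReal.mul_lt_top (ENNReal.inv_lt_top.2 (pos_iff_ne_zero.2 h0)) h

theorem lorentzIntegral_mono (hDD : D ⊆ D') (hD' : volume D' ≠ ∞)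
    (h : ∀ᵐ x ∂volume, x ∈ D → u x ≤ v x) :
    lorentzIntegral p D u ≤ lorentzIntegral p D' v := by
  unfold lorentzIntegral
  refine (lintegral_mono_set (Ioo_subset_Ioo_right
    (ENNReal.toReal_mono hD' (measure_mono hDD)))).trans ?_
  gcongr
  exact rearrangement_mono_of_ae hDD h _

theorem lorentzIntegral_const_mul {c : ℝ≥0∞} (hc : c ≠ ∞) :
    lorentzIntegral p D (fun x => c * u x) ≤ c * lorentzIntegral p D u := by
  rcases eq_or_ne c 0 with rfl | h0
  · have : ∀ s, rearrangement D (fun _ => (0 : ℝ≥0∞)) s ≤ 0 := fun s =>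
      rearrangement_le_iff.2 (by simp [distribution])
    simp only [zero_mul, lorentzIntegral, nonpos_iff_eq_zero.1 (this _)]
    simp
  · unfold lorentzIntegral
    simp_rw [rearrangement_const_mul h0 hc]
    rw [← lintegral_const_mul' _ _ hc]
    refine lintegral_mono fun t => ?_
    rw [lintegral_const_mul _ rearrangement_antitone.measurable, mul_left_comm]

theorem lorentzIntegral_add_const (hp : 0 < p) (c : ℝ≥0∞) :
    lorentzIntegral p D (fun x => u x + c) ≤
      lorentzIntegral p D u + ENNReal.ofReal ((volume D).toReal ^ (1 / p) / (1 / p)) * c := by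
  have hw : Measurable fun t : ℝ => ENNReal.ofReal (t ^ (1 / p - 1)) := by fun_prop
  unfold lorentzIntegral
  rw [← lintegral_Ioo_rpow (one_div_pos.2 hp) ENNReal.toReal_nonneg, ← lintegral_mul_const _ hw,
    ← lintegral_add_right _ (hw.mul_const _)]
  refine setLIntegral_mono' measurableSet_Ioo fun t ht => ?_
  have ht0 : 0 < t := ht.1
  calc _ ≤ ENNReal.ofReal (t ^ (1 / p - 2)) * ∫⁻ s in Ioo 0 t, (rearrangement D u s + c) := by
        gcongr
        exact rearrangement_add_const_le c _
    _ = _ := by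
        rw [lintegral_add_right _ measurable_const, setLIntegral_const, mul_add]
        congr 1
        rw [Real.volume_Ioo, sub_zero, mul_comm c, ← mul_assoc, ← ENNReal.ofReal_mul (by positivity)]
        congr 2
        nth_rewrite 2 [← Real.rpow_one t]
        rw [← Real.rpow_add ht0]
        congr 1
        ring

/-- Tonelli turns the functional into an integral over levels in which `u` enters only through the
measures of its superlevel sets. Bounds can then be checked for one set at a time. -/
theorem lorentzIntegral_eq_lintegral_distribution :
    lorentzIntegral p D u = ∫⁻ l in Ioi (0 : ℝ), ∫⁻ t in Ioo 0 (volume D).toReal,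
      ENNReal.ofReal (t ^ (1 / p - 2)) *
        min (ENNReal.ofReal t) (distribution D u (ENNReal.ofReal l)) := by
  have hm : Measurable fun l : ℝ => distribution D u (ENNReal.ofReal l) :=
    distribution_antitone.measurable.comp ENNReal.measurable_ofReal
  rw [lintegral_lintegral_swap]
  · unfold lorentzIntegral
    refine lintegral_congr fun t => ?_
    rw [lintegral_rearrangement, lintegral_const_mul]
    exact measurable_const.min hm
  · refine Measurable.aemeasurable ?_
    exact (by fun_prop : Measurable fun q : ℝ × ℝ => ENNReal.ofReal (q.2 ^ (1 / p - 2))).mul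
      ((by fun_prop : Measurable fun q : ℝ × ℝ => ENNReal.ofReal q.2).min
        (hm.comp measurable_fst))

/-- Write `m = s` and split at `t = s`. Beyond `s` the two integrands agree; below `s` the integrals
are `n s^{2/n}` and `(n/2) s^{2/n}`, whence the factor `2`. The range beyond `s` is never
integrated, so the logarithm that arises for `n = 2` plays no role. -/
theorem lintegral_layerBound_le (hn : 2 ≤ n) {T : ℝ} {m : ℝ≥0∞} (hm : m ≤ ENNReal.ofReal T) :
    ∫⁻ t in Ioo 0 T, ENNReal.ofReal (t ^ (1 / (n : ℝ) - 2)) * layerBound n t m ≤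
      2 * ∫⁻ t in Ioo 0 T, ENNReal.ofReal (t ^ (1 / ((n : ℝ) / 2) - 2)) *
        min (ENNReal.ofReal t) m := by
  have hn0 : (0 : ℝ) < n := by positivity
  obtain ⟨s, hs0, rfl⟩ : ∃ s : ℝ, 0 ≤ s ∧ ENNReal.ofReal s = m :=
    ⟨m.toReal, ENNReal.toReal_nonneg,
      ENNReal.ofReal_toReal (hm.trans_lt ENNReal.ofReal_lt_top).ne⟩
  rcases hs0.eq_or_lt with rfl | hs
  · have hn1 : (0 : ℝ) < (n : ℝ)⁻¹ := by positivity
    simp [layerBound]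
  have hsT : s ≤ T := by
    by_contra! h
    rcases le_or_gt T 0 with hT | hT
    · rw [ENNReal.ofReal_of_nonpos hT] at hm
      simp only [nonpos_iff_eq_zero, ENNReal.ofReal_eq_zero] at hm
      linarith
    · exact absurd ((ENNReal.ofReal_le_ofReal_iff hT.le).1 hm) (not_le.2 h)
  have hun : Ioo 0 T = Ioo 0 s ∪ Ico s T := (Ioo_union_Ico_eq_Ioo hs hsT).symm
  have hdis : Disjoint (Ioo 0 s) (Ico s T) :=
    Set.disjoint_left.2 fun t h1 h2 => absurd h1.2 (not_lt.2 h2.1)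
  rw [hun, lintegral_union measurableSet_Ico hdis, lintegral_union measurableSet_Ico hdis, mul_add]
  refine add_le_add ?_ ?_
  · have h1 : ∫⁻ t in Ioo 0 s, ENNReal.ofReal (t ^ (1 / (n : ℝ) - 2)) *
        layerBound n t (ENNReal.ofReal s) =
        ENNReal.ofReal (s ^ (1 / (n : ℝ))) * ∫⁻ t in Ioo 0 s, ENNReal.ofReal (t ^ (1 / (n : ℝ) - 1)) := by
      rw [← lintegral_const_mul _ (by fun_prop)]
      refine setLIntegral_congr_fun measurableSet_Ioo fun t ht => ?_
      have ht0 : 0 < t := ht.1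
      have hlt : ¬ ENNReal.ofReal s ≤ ENNReal.ofReal t :=
        not_le.2 ((ENNReal.ofReal_lt_ofReal_iff hs).2 ht.2)
      simp only [layerBound, if_neg hlt]
      rw [ENNReal.ofReal_rpow_of_pos hs, ← mul_assoc, ← ENNReal.ofReal_mul (by positivity), mul_comm]
      congr 2
      nth_rewrite 2 [← Real.rpow_one t]
      rw [← Real.rpow_add ht0]
      congr 1
      ring
    have h2 : ∫⁻ t in Ioo 0 s, ENNReal.ofReal (t ^ (1 / ((n : ℝ) / 2) - 2)) *
        min (ENNReal.ofReal t) (ENNReal.ofReal s) =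
        ∫⁻ t in Ioo 0 s, ENNReal.ofReal (t ^ (1 / ((n : ℝ) / 2) - 1)) := by
      refine setLIntegral_congr_fun measurableSet_Ioo fun t ht => ?_
      have ht0 : 0 < t := ht.1
      rw [min_eq_left (ENNReal.ofReal_le_ofReal ht.2.le), ← ENNReal.ofReal_mul (by positivity)]
      congr 1
      nth_rewrite 2 [← Real.rpow_one t]
      rw [← Real.rpow_add ht0]
      congr 1
      ring
    rw [h1, h2, lintegral_Ioo_rpow (by positivity) hs.le, lintegral_Ioo_rpow (by positivity) hs.le,
      ← ENNReal.ofReal_mul (by positivity)]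
    have h2' : (2 : ℝ≥0∞) = ENNReal.ofReal 2 := by simp
    rw [h2', ← ENNReal.ofReal_mul (by positivity)]
    refine ENNReal.ofReal_le_ofReal (le_of_eq ?_)
    have : s ^ (1 / ((n : ℝ) / 2)) = s ^ (1 / (n : ℝ)) * s ^ (1 / (n : ℝ)) := by
      rw [← Real.rpow_add hs]
      congr 1
      field_simp
      ring
    rw [this]
    field_simp
  · refine le_trans ?_ (le_mul_of_one_le_left zero_le one_le_two)
    refine setLIntegral_mono' measurableSet_Ico fun t ht => ?_
    have ht0 : 0 < t := hs.trans_le ht.1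
    have hle : ENNReal.ofReal s ≤ ENNReal.ofReal t := ENNReal.ofReal_le_ofReal ht.1
    rw [layerBound, if_pos hle, min_eq_right hle, mul_left_comm, ← ENNReal.ofReal_mul (by positivity),
      ← Real.rpow_add ht0, mul_comm]
    refine le_of_eq ?_
    congr 3
    field_simp
    ring

/-- The Riesz potential of order one maps `L^{n/2,1}(D)` into `L^{n,1}(D)`. -/
theorem lorentzIntegral_rieszPotential_le (hn : 2 ≤ n) (hD : MeasurableSet D)
    (hDf : volume D ≠ ∞) {g : EuclideanSpace ℝ (Fin n) → ℝ≥0∞} (hg : Measurable g) :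
    lorentzIntegral (n : ℝ) D (rieszPotential (D.indicator g)) ≤
      ENNReal.ofReal (rieszMass n + 1) * (2 * lorentzIntegral ((n : ℝ) / 2) D g) := by
  have hm : Measurable fun l : ℝ => distribution D g (ENNReal.ofReal l) :=
    distribution_antitone.measurable.comp ENNReal.measurable_ofReal
  have hw : Measurable fun t : ℝ => ENNReal.ofReal (t ^ (1 / (n : ℝ) - 2)) := by fun_prop
  have hjoint : Measurable fun q : ℝ × ℝ =>
      layerBound n q.1 (distribution D g (ENNReal.ofReal q.2)) :=
    measurable_layerBound.comp (measurable_fst.prodMk (hm.comp measurable_snd))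
  calc _ ≤ ∫⁻ t in Ioo 0 (volume D).toReal, ENNReal.ofReal (rieszMass n + 1) *
          ∫⁻ l in Ioi (0 : ℝ), ENNReal.ofReal (t ^ (1 / (n : ℝ) - 2)) *
            layerBound n t (distribution D g (ENNReal.ofReal l)) := by
        refine setLIntegral_mono' measurableSet_Ioo fun t ht => ?_
        rw [lintegral_const_mul' _ _ ENNReal.ofReal_ne_top, mul_left_comm]
        gcongr
        exact lintegral_rearrangement_rieszPotential_le hn hD hDf hg ht.1
    _ = ENNReal.ofReal (rieszMass n + 1) * ∫⁻ l in Ioi (0 : ℝ),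
          ∫⁻ t in Ioo 0 (volume D).toReal, ENNReal.ofReal (t ^ (1 / (n : ℝ) - 2)) *
            layerBound n t (distribution D g (ENNReal.ofReal l)) := by
        rw [lintegral_const_mul, lintegral_lintegral_swap]
        · exact ((hw.comp measurable_fst).mul hjoint).aemeasurable
        · exact Measurable.lintegral_prod_right' ((hw.comp measurable_fst).mul hjoint)
    _ ≤ _ := by
        rw [lorentzIntegral_eq_lintegral_distribution,
          ← lintegral_const_mul' _ _ ENNReal.ofNat_ne_top]
        gcongr with l
        refine lintegral_layerBound_le hn ?_
        rw [ENNReal.ofReal_toReal hDf]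
        exact distribution_le_measure _

/-- The Riesz potential of order one maps `L^{n,1}(D)` into `L^∞`. -/
theorem rieszPotential_le_lorentzIntegral (hn : 2 ≤ n) (hD : MeasurableSet D)
    (hDf : volume D ≠ ∞) {g : EuclideanSpace ℝ (Fin n) → ℝ≥0∞} (hg : Measurable g)
    (x : EuclideanSpace ℝ (Fin n)) :
    rieszPotential (D.indicator g) x ≤
      ENNReal.ofReal (rieszMass n + 1) * lorentzIntegral (n : ℝ) D g := by
  have hn0 : (0 : ℝ) < n := by positivity
  have hK : Measurable fun y => rieszKernel (x - y) :=
    measurable_rieszKernel.comp (measurable_const.sub measurable_id)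
  rw [rieszPotential, lintegral_mul_eq_lintegral_superlevel (hg.indicator hD) hK,
    lorentzIntegral_eq_lintegral_distribution, ← lintegral_const_mul' _ _ ENNReal.ofReal_ne_top]
  refine lintegral_mono fun l => ?_
  simp_rw [distribution_indicator]
  have hle : distribution D g (ENNReal.ofReal l) ≤ volume D := distribution_le_measure _
  have hfin : distribution D g (ENNReal.ofReal l) ≠ ∞ := (hle.trans_lt hDf.lt_top).ne
  refine (setLIntegral_rieszKernel_le hn _ hfin x).trans ?_
  change _ * distribution D g (ENNReal.ofReal l) ^ _ ≤ _
  gcongr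
  set s := (distribution D g (ENNReal.ofReal l)).toReal
  have hs0 : 0 ≤ s := ENNReal.toReal_nonneg
  have hs : distribution D g (ENNReal.ofReal l) = ENNReal.ofReal s :=
    (ENNReal.ofReal_toReal hfin).symm
  have hsT : s ≤ (volume D).toReal := ENNReal.toReal_mono hDf hle
  rw [hs, ENNReal.ofReal_rpow_of_nonneg hs0 (by positivity)]
  -- The range `t < s` of the Lorentz integral alone equals `n s^{1/n}`, which already suffices.
  calc _ ≤ ENNReal.ofReal (s ^ (1 / (n : ℝ)) / (1 / (n : ℝ))) := by
        refine ENNReal.ofReal_le_ofReal ?_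
        have : (1 : ℝ) ≤ n := by exact_mod_cast (by lia : 1 ≤ n)
        rw [div_div_eq_mul_div, div_one]
        exact le_mul_of_one_le_right (by positivity) this
    _ = ∫⁻ t in Ioo 0 s, ENNReal.ofReal (t ^ (1 / (n : ℝ) - 1)) :=
        (lintegral_Ioo_rpow (by positivity) hs0).symm
    _ ≤ ∫⁻ t in Ioo 0 s, ENNReal.ofReal (t ^ (1 / (n : ℝ) - 2)) *
          min (ENNReal.ofReal t) (ENNReal.ofReal s) := by
        refine setLIntegral_mono' measurableSet_Ioo fun t ht => ?_
        have ht0 : 0 < t := ht.1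
        rw [min_eq_left (ENNReal.ofReal_le_ofReal ht.2.le), ← ENNReal.ofReal_mul (by positivity)]
        refine ENNReal.ofReal_le_ofReal (le_of_eq ?_)
        nth_rewrite 3 [← Real.rpow_one t]
        rw [← Real.rpow_add ht0]
        congr 1
        ring
    _ ≤ _ := lintegral_mono_set (Ioo_subset_Ioo_right hsT)

end Lorentz

/-! ### Pointwise bounds of a function and its gradient by potentials. -/

section Representation

/-- The `i`-th component of the regularised kernel `z (|z|² + δ²)^{-n/2}`. -/
def regKernel (δ : ℝ) (i : Fin n) (z : EuclideanSpace ℝ (Fin n)) : ℝ :=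
  z i * (‖z‖ ^ 2 + δ ^ 2) ^ (-(n : ℝ) / 2)

/-- The divergence of the regularised kernel. -/
def regDiv (n : ℕ) (δ : ℝ) (z : EuclideanSpace ℝ (Fin n)) : ℝ :=
  n * δ ^ 2 * (‖z‖ ^ 2 + δ ^ 2) ^ (-(n : ℝ) / 2 - 1)

variable {δ : ℝ}

theorem hasFDerivAt_regKernel (hδ : 0 < δ) (i : Fin n) (z : EuclideanSpace ℝ (Fin n)) :
    HasFDerivAt (regKernel δ i)
      (z i • ((-(n : ℝ) / 2 * (‖z‖ ^ 2 + δ ^ 2) ^ (-(n : ℝ) / 2 - 1)) • (2 • innerSL ℝ z)) +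
        (‖z‖ ^ 2 + δ ^ 2) ^ (-(n : ℝ) / 2) • EuclideanSpace.proj i) z := by
  have h1 : HasFDerivAt (𝕜 := ℝ) (F := ℝ) (fun z : EuclideanSpace ℝ (Fin n) => z i)
      (EuclideanSpace.proj i : EuclideanSpace ℝ (Fin n) →L[ℝ] ℝ) z :=
    (EuclideanSpace.proj i : EuclideanSpace ℝ (Fin n) →L[ℝ] ℝ).hasFDerivAt
  have h2 : HasFDerivAt (fun z : EuclideanSpace ℝ (Fin n) => ‖z‖ ^ 2 + δ ^ 2) (2 • innerSL ℝ z) z :=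
    (hasStrictFDerivAt_norm_sq z).hasFDerivAt.add_const _
  exact h1.mul (h2.rpow_const (p := -(n : ℝ) / 2) (.inl (by positivity)))

theorem contDiff_regKernel (hδ : 0 < δ) (i : Fin n) : ContDiff ℝ 1 (regKernel δ i) := by
  unfold regKernel
  refine ContDiff.mul (by fun_prop) ?_
  exact ContDiff.rpow_const_of_ne ((contDiff_norm_sq ℝ).add contDiff_const)
    fun z => by positivity

theorem fderiv_regKernel (hδ : 0 < δ) (i j : Fin n) (z : EuclideanSpace ℝ (Fin n)) :
    fderiv ℝ (regKernel δ i) z (EuclideanSpace.single j 1) =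
      (if i = j then (‖z‖ ^ 2 + δ ^ 2) ^ (-(n : ℝ) / 2) else 0) -
        n * (z i * z j) * (‖z‖ ^ 2 + δ ^ 2) ^ (-(n : ℝ) / 2 - 1) := by
  rw [(hasFDerivAt_regKernel hδ i z).fderiv]
  by_cases h : i = j
  · subst h
    simp [EuclideanSpace.inner_single_right]
    ring
  · simp [EuclideanSpace.inner_single_right, h]
    ring

/-- The field is a scalar function of `|z|` times `z`, hence a gradient, so its Jacobian is
symmetric. This symmetry is what brings out the Laplacian rather than the full Hessian. -/
theorem fderiv_regKernel_comm (hδ : 0 < δ) (i j : Fin n) (z : EuclideanSpace ℝ (Fin n)) :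
    fderiv ℝ (regKernel δ i) z (EuclideanSpace.single j 1) =
      fderiv ℝ (regKernel δ j) z (EuclideanSpace.single i 1) := by
  rw [fderiv_regKernel hδ, fderiv_regKernel hδ, mul_comm (z i)]
  simp only [eq_comm]

theorem sum_fderiv_regKernel (hδ : 0 < δ) (z : EuclideanSpace ℝ (Fin n)) :
    ∑ j, fderiv ℝ (regKernel δ j) z (EuclideanSpace.single j 1) = regDiv n δ z := by
  simp_rw [fderiv_regKernel hδ, if_true]
  rw [Finset.sum_sub_distrib, ← Finset.sum_mul, ← Finset.mul_sum]
  have h1 : ∑ i, z i * z i = ‖z‖ ^ 2 := by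
    rw [EuclideanSpace.real_norm_sq_eq]; simp [sq]
  have hpos : 0 < ‖z‖ ^ 2 + δ ^ 2 := by positivity
  have h2 : (‖z‖ ^ 2 + δ ^ 2) ^ (-(n : ℝ) / 2) =
      (‖z‖ ^ 2 + δ ^ 2) * (‖z‖ ^ 2 + δ ^ 2) ^ (-(n : ℝ) / 2 - 1) := by
    nth_rewrite 2 [← Real.rpow_one (‖z‖ ^ 2 + δ ^ 2)]
    rw [← Real.rpow_add hpos]
    congr 1
    ring
  simp only [Finset.sum_const, Finset.card_univ, Fintype.card_fin, nsmul_eq_mul]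
  rw [h1, h2, regDiv]
  ring

theorem norm_mul_rpow_le (z : EuclideanSpace ℝ (Fin n)) :
    ‖z‖ * (‖z‖ ^ 2 + δ ^ 2) ^ (-(n : ℝ) / 2) ≤ ‖z‖ ^ (1 - (n : ℝ)) := by
  rcases eq_or_ne z 0 with rfl | hz
  · simp only [norm_zero, zero_mul]; positivity
  have hz' : 0 < ‖z‖ := norm_pos_iff.2 hz
  calc _ ≤ ‖z‖ * (‖z‖ ^ 2) ^ (-(n : ℝ) / 2) := by
        gcongr ?_ * ?_
        have : (0 : ℝ) ≤ n := n.cast_nonneg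
        exact Real.rpow_le_rpow_of_nonpos (by positivity) (by nlinarith [sq_nonneg δ])
          (by linarith)
    _ = _ := by
        rw [← Real.rpow_natCast ‖z‖ 2, ← Real.rpow_mul hz'.le]
        nth_rewrite 1 [← Real.rpow_one ‖z‖]
        rw [← Real.rpow_add hz']
        congr 1
        push_cast
        ring

theorem integral_mul_fderiv_of_hasCompactSupport {f g : EuclideanSpace ℝ (Fin n) → ℝ}
    (hf : ContDiff ℝ 1 f) (hg : ContDiff ℝ 1 g) (hc : HasCompactSupport g)
    (v : EuclideanSpace ℝ (Fin n)) :
    ∫ x, f x * fderiv ℝ g x v = - ∫ x, fderiv ℝ f x v * g x := by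
  have hf' : Continuous fun x => fderiv ℝ f x v :=
    (hf.continuous_fderiv one_ne_zero).clm_apply continuous_const
  have hg' : Continuous fun x => fderiv ℝ g x v :=
    (hg.continuous_fderiv one_ne_zero).clm_apply continuous_const
  refine integral_mul_fderiv_eq_neg_fderiv_mul_of_integrable ?_ ?_ ?_
    (fun x _ => hf.differentiable one_ne_zero x) (fun x _ => hg.differentiable one_ne_zero x)
  · exact (hf'.mul hg.continuous).integrable_of_hasCompactSupport hc.mul_left
  · exact (hf.continuous.mul hg').integrable_of_hasCompactSupport (hc.fderiv_apply ℝ v).mul_left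
  · exact (hf.continuous.mul hg.continuous).integrable_of_hasCompactSupport hc.mul_left

theorem integral_mul_regDiv (hδ : 0 < δ) {u : EuclideanSpace ℝ (Fin n) → ℝ}
    (hu : ContDiff ℝ 1 u) (hc : HasCompactSupport u) :
    ∫ z, u z * regDiv n δ z =
      - ∑ j, ∫ z, regKernel δ j z * fderiv ℝ u z (EuclideanSpace.single j 1) := by
  simp_rw [← sum_fderiv_regKernel hδ, Finset.mul_sum]
  rw [integral_finsetSum, ← Finset.sum_neg_distrib]
  · refine Finset.sum_congr rfl fun j _ => ?_
    rw [integral_mul_fderiv_of_hasCompactSupport (contDiff_regKernel hδ j) hu hc, neg_neg]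
    simp_rw [mul_comm]
  · intro j _
    refine (hu.continuous.mul ?_).integrable_of_hasCompactSupport hc.mul_right
    exact ((contDiff_regKernel hδ j).continuous_fderiv one_ne_zero).clm_apply continuous_const

theorem contDiff_fderiv_apply {u : EuclideanSpace ℝ (Fin n) → ℝ} (hu : ContDiff ℝ 2 u)
    (v : EuclideanSpace ℝ (Fin n)) : ContDiff ℝ 1 fun z => fderiv ℝ u z v :=
  (hu.fderiv_right (m := 1) (by norm_num)).clm_apply contDiff_const

theorem fderiv_fderiv_apply {u : EuclideanSpace ℝ (Fin n) → ℝ} (hu : ContDiff ℝ 2 u)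
    (v w z : EuclideanSpace ℝ (Fin n)) :
    fderiv ℝ (fun z => fderiv ℝ u z v) z w = fderiv ℝ (fderiv ℝ u) z w v := by
  have h : DifferentiableAt ℝ (fderiv ℝ u) z :=
    (hu.fderiv_right (m := 1) (by norm_num)).differentiable one_ne_zero z
  rw [fderiv_clm_apply h (by fun_prop)]
  simp

theorem laplacian_eq_sum {u : EuclideanSpace ℝ (Fin n) → ℝ} (z : EuclideanSpace ℝ (Fin n)) :
    Laplacian.laplacian u z = ∑ j, fderiv ℝ (fderiv ℝ u) z (EuclideanSpace.single j 1)
      (EuclideanSpace.single j 1) := by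
  rw [InnerProductSpace.laplacian_eq_iteratedFDeriv_orthonormalBasis u
    (EuclideanSpace.basisFun (Fin n) ℝ)]
  simp [iteratedFDeriv_two_apply]

/-- Three integrations by parts: one moves the divergence onto `∂ᵢu`, and two more exchange the
indices in `∫ kⱼ ∂ᵢ∂ⱼu = ∫ kᵢ ∂ⱼ∂ⱼu`, using `∂ᵢkⱼ = ∂ⱼkᵢ`. Summing over `j` leaves `Δu`. -/
theorem integral_fderiv_mul_regDiv (hδ : 0 < δ) {u : EuclideanSpace ℝ (Fin n) → ℝ}
    (hu : ContDiff ℝ 2 u) (hc : HasCompactSupport u) (i : Fin n) :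
    ∫ z, fderiv ℝ u z (EuclideanSpace.single i 1) * regDiv n δ z =
      - ∫ z, regKernel δ i z * Laplacian.laplacian u z := by
  have hsym : ∀ z v w, fderiv ℝ (fderiv ℝ u) z v w = fderiv ℝ (fderiv ℝ u) z w v := fun z v w =>
    (hu.contDiffAt.isSymmSndFDerivAt (x := z) (by simp)) v w
  have hcont : ∀ v w, Continuous fun z => fderiv ℝ (fderiv ℝ u) z v w := fun v w =>
    ((((hu.fderiv_right (m := 1) (by norm_num)).continuous_fderiv one_ne_zero).clm_apply
      continuous_const).clm_apply continuous_const)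
  have hsupp : ∀ v w, HasCompactSupport fun z => fderiv ℝ (fderiv ℝ u) z v w := fun v w => by
    simpa only [fderiv_fderiv_apply hu] using (hc.fderiv_apply ℝ w).fderiv_apply ℝ v
  rw [integral_mul_regDiv hδ (contDiff_fderiv_apply hu _) (hc.fderiv_apply ℝ _)]
  simp_rw [laplacian_eq_sum, Finset.mul_sum]
  rw [integral_finsetSum]
  · congr 1
    refine Finset.sum_congr rfl fun j _ => ?_
    calc _ = ∫ z, regKernel δ j z * fderiv ℝ (fun z => fderiv ℝ u z (EuclideanSpace.single j 1)) z
          (EuclideanSpace.single i 1) := by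
          simp_rw [fderiv_fderiv_apply hu]
          refine integral_congr_ae (Eventually.of_forall fun z => ?_)
          simp only
          rw [hsym]
      _ = - ∫ z, fderiv ℝ (regKernel δ i) z (EuclideanSpace.single j 1) *
          fderiv ℝ u z (EuclideanSpace.single j 1) := by
          rw [integral_mul_fderiv_of_hasCompactSupport (contDiff_regKernel hδ j)
            (contDiff_fderiv_apply hu _) (hc.fderiv_apply ℝ _)]
          simp_rw [fderiv_regKernel_comm hδ j i]
      _ = _ := by
          rw [← integral_mul_fderiv_of_hasCompactSupport (contDiff_regKernel hδ i)
            (contDiff_fderiv_apply hu _) (hc.fderiv_apply ℝ _)]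
          simp_rw [fderiv_fderiv_apply hu]
  · intro j _
    exact ((contDiff_regKernel hδ i).continuous.mul
      (hcont _ _)).integrable_of_hasCompactSupport (hsupp _ _).mul_left

/-- The total mass of the divergence of the regularised kernel. -/
def divMass (n : ℕ) : ℝ :=
  ∫ y : EuclideanSpace ℝ (Fin n), n * (1 + ‖y‖ ^ 2) ^ (-((n : ℝ) + 2) / 2)

theorem integrable_divMass :
    Integrable fun y : EuclideanSpace ℝ (Fin n) => n * (1 + ‖y‖ ^ 2) ^ (-((n : ℝ) + 2) / 2) := by
  refine (integrable_rpow_neg_one_add_norm_sq ?_).const_mul _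
  rw [finrank_euclideanSpace_fin]
  linarith

theorem divMass_pos (hn : 2 ≤ n) : 0 < divMass n := by
  have hn0 : (0 : ℝ) < n := by positivity
  rw [divMass, integral_pos_iff_support_of_nonneg (fun y => by positivity) integrable_divMass]
  have : Function.support (fun y : EuclideanSpace ℝ (Fin n) =>
      n * (1 + ‖y‖ ^ 2) ^ (-((n : ℝ) + 2) / 2)) = univ := by
    ext y
    have : 0 < (n : ℝ) * (1 + ‖y‖ ^ 2) ^ (-((n : ℝ) + 2) / 2) := by positivity
    simp only [Function.mem_support, mem_univ, iff_true]
    exact this.ne'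
  rw [this]
  exact isOpen_univ.measure_pos _ univ_nonempty

/-- The substitution `z = δ y` shows that the divergences are the dilates of one integrable profile,
that is, an approximate identity up to normalisation. -/
theorem integral_mul_regDiv_eq (hδ : 0 < δ) (f : EuclideanSpace ℝ (Fin n) → ℝ) :
    ∫ z, f z * regDiv n δ z =
      ∫ y, f (δ • y) * (n * (1 + ‖y‖ ^ 2) ^ (-((n : ℝ) + 2) / 2)) := by
  have h := Measure.integral_comp_smul_of_nonneg (volume : Measure (EuclideanSpace ℝ (Fin n)))
    (fun z => f z * regDiv n δ z) δ (hR := hδ.le)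
  rw [smul_eq_mul, eq_inv_mul_iff_mul_eq₀ (by positivity), ← integral_const_mul] at h
  rw [← h]
  refine integral_congr_ae (Eventually.of_forall fun y => ?_)
  simp only [regDiv, finrank_euclideanSpace_fin, norm_smul, Real.norm_of_nonneg hδ.le]
  have h1 : (δ * ‖y‖) ^ 2 + δ ^ 2 = δ ^ 2 * (1 + ‖y‖ ^ 2) := by ring
  have h2 : δ ^ n * (δ ^ 2 * (δ ^ 2) ^ (-(n : ℝ) / 2 - 1)) = 1 := by
    rw [← Real.rpow_natCast δ n, ← Real.rpow_natCast δ 2, ← Real.rpow_mul hδ.le,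
      ← Real.rpow_add hδ, ← Real.rpow_add hδ]
    convert Real.rpow_zero δ using 2
    push_cast
    ring
  have h3 : -((n : ℝ) + 2) / 2 = -(n : ℝ) / 2 - 1 := by ring
  rw [h1, Real.mul_rpow (by positivity) (by positivity), h3]
  linear_combination f (δ • y) * n * (1 + ‖y‖ ^ 2) ^ (-(n : ℝ) / 2 - 1) * h2

theorem tendsto_integral_mul_regDiv {f : EuclideanSpace ℝ (Fin n) → ℝ}
    (hf : Continuous f) (hc : HasCompactSupport f) :
    Tendsto (fun k : ℕ => ∫ z, f z * regDiv n (1 / ((k : ℝ) + 1)) z) atTop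
      (𝓝 (f 0 * divMass n)) := by
  obtain ⟨C, hC⟩ := hf.bounded_above_of_compact_support hc
  simp_rw [fun k : ℕ => integral_mul_regDiv_eq (n := n) (δ := 1 / ((k : ℝ) + 1))
    (by positivity) f]
  rw [divMass, ← integral_const_mul]
  refine tendsto_integral_of_dominated_convergence
    (fun y => C * (n * (1 + ‖y‖ ^ 2) ^ (-((n : ℝ) + 2) / 2))) ?_
    (integrable_divMass.const_mul C) ?_ ?_
  · intro k
    exact ((hf.comp (continuous_const_smul _)).aestronglyMeasurable).mul
      integrable_divMass.aestronglyMeasurable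
  · refine fun k => Eventually.of_forall fun y => ?_
    have : 0 ≤ (n : ℝ) * (1 + ‖y‖ ^ 2) ^ (-((n : ℝ) + 2) / 2) := by positivity
    rw [norm_mul, Real.norm_of_nonneg this]
    gcongr
    exact hC _
  · refine Eventually.of_forall fun y => Tendsto.mul_const _ ?_
    have h : Tendsto (fun k : ℕ => (1 / ((k : ℝ) + 1)) • y) atTop (𝓝 ((0 : ℝ) • y)) :=
      (tendsto_one_div_add_atTop_nhds_zero_nat).smul_const y
    rw [zero_smul] at h
    exact (hf.tendsto 0).comp h

/-- A bound uniform in `δ` survives the limit `δ → 0`. Working only at the origin suffices, since it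
is applied to translates. -/
theorem enorm_mul_divMass_le {f : EuclideanSpace ℝ (Fin n) → ℝ} {M : ℝ≥0∞}
    (hf : Continuous f) (hc : HasCompactSupport f)
    (h : ∀ δ : ℝ, 0 < δ → ‖∫ z, f z * regDiv n δ z‖ₑ ≤ M) :
    ENNReal.ofReal (divMass n) * ‖f 0‖ₑ ≤ M := by
  have h1 := (tendsto_integral_mul_regDiv hf hc).enorm
  have h2 : ‖f 0 * divMass n‖ₑ ≤ M :=
    le_of_tendsto h1 (Eventually.of_forall fun k => h _ (by positivity))
  rwa [enorm_mul, mul_comm, Real.enorm_of_nonneg] at h2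
  exact integral_nonneg fun y => by positivity

theorem enorm_regKernel_le (i : Fin n) (z : EuclideanSpace ℝ (Fin n)) :
    ‖regKernel δ i z‖ₑ ≤ rieszKernel z := by
  rw [← ofReal_norm, rieszKernel]
  refine ENNReal.ofReal_le_ofReal (le_trans ?_ (norm_mul_rpow_le (δ := δ) z))
  have : 0 ≤ (‖z‖ ^ 2 + δ ^ 2) ^ (-(n : ℝ) / 2) := by positivity
  rw [regKernel, norm_mul, Real.norm_of_nonneg this]
  gcongr
  exact PiLp.norm_apply_le z i

theorem lintegral_translate_rieszKernel (g : EuclideanSpace ℝ (Fin n) → ℝ≥0∞)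
    (x : EuclideanSpace ℝ (Fin n)) :
    ∫⁻ z, g (x + z) * rieszKernel z = rieszPotential g x := by
  rw [rieszPotential, ← lintegral_add_left_eq_self (fun y => g y * rieszKernel (x - y)) x]
  refine lintegral_congr fun z => ?_
  simp [rieszKernel]

/-- Pointwise control of a function by the Riesz potential of its derivative. -/
theorem enorm_le_rieszPotential_fderiv {u : EuclideanSpace ℝ (Fin n) → ℝ}
    (hu : ContDiff ℝ 1 u) (hc : HasCompactSupport u) (x : EuclideanSpace ℝ (Fin n)) :
    ENNReal.ofReal (divMass n) * ‖u x‖ₑ ≤ n * rieszPotential (fun y => ‖fderiv ℝ u y‖ₑ) x := by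
  have hv : ContDiff ℝ 1 fun z => u (x + z) := hu.comp (contDiff_const.add contDiff_id)
  have hvc : HasCompactSupport fun z => u (x + z) :=
    hc.comp_homeomorph (Homeomorph.addLeft x)
  have := enorm_mul_divMass_le (f := fun z => u (x + z))
    (M := n * rieszPotential (fun y => ‖fderiv ℝ u y‖ₑ) x) hv.continuous hvc ?_
  · simpa using this
  intro δ hδ
  rw [integral_mul_regDiv hδ hv hvc, enorm_neg]
  refine (enorm_sum_le _ _).trans ?_
  calc _ ≤ ∑ _j : Fin n, rieszPotential (fun y => ‖fderiv ℝ u y‖ₑ) x := by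
        refine Finset.sum_le_sum fun j _ => ?_
        refine (enorm_integral_le_lintegral_enorm _).trans ?_
        rw [← lintegral_translate_rieszKernel]
        refine lintegral_mono fun z => ?_
        rw [enorm_mul, mul_comm, fderiv_comp_add_left]
        gcongr
        · refine (ContinuousLinearMap.le_opENorm _ _).trans ?_
          simp [enorm_eq_nnnorm]
        · exact enorm_regKernel_le j z
    _ = _ := by simp

/-- Pointwise control of the gradient by the Riesz potential of the Laplacian. -/
theorem enorm_fderiv_le_rieszPotential_laplacian {u : EuclideanSpace ℝ (Fin n) → ℝ}
    (hu : ContDiff ℝ 2 u) (hc : HasCompactSupport u) (x : EuclideanSpace ℝ (Fin n)) (i : Fin n) :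
    ENNReal.ofReal (divMass n) * ‖fderiv ℝ u x (EuclideanSpace.single i 1)‖ₑ ≤
      rieszPotential (fun y => ‖Laplacian.laplacian u y‖ₑ) x := by
  have hv : ContDiff ℝ 2 fun z => u (x + z) := hu.comp (contDiff_const.add contDiff_id)
  have hvc : HasCompactSupport fun z => u (x + z) :=
    hc.comp_homeomorph (Homeomorph.addLeft x)
  have hd : ∀ z, fderiv ℝ (fun z => u (x + z)) z = fderiv ℝ u (x + z) := fun z =>
    fderiv_comp_add_left x
  have hlap : ∀ z, Laplacian.laplacian (fun z => u (x + z)) z = Laplacian.laplacian u (x + z) := by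
    intro z
    simp_rw [laplacian_eq_sum]
    rw [funext hd, fderiv_comp_add_left (f := fderiv ℝ u)]
  have := enorm_mul_divMass_le
    (f := fun z => fderiv ℝ (fun z => u (x + z)) z (EuclideanSpace.single i 1))
    (M := rieszPotential (fun y => ‖Laplacian.laplacian u y‖ₑ) x)
    (contDiff_fderiv_apply hv _).continuous (hvc.fderiv_apply ℝ _) ?_
  · simpa [hd] using this
  intro δ hδ
  rw [integral_fderiv_mul_regDiv hδ hv hvc, enorm_neg]
  refine (enorm_integral_le_lintegral_enorm _).trans ?_
  rw [← lintegral_translate_rieszKernel]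
  refine lintegral_mono fun z => ?_
  rw [enorm_mul, mul_comm, hlap]
  gcongr
  exact enorm_regKernel_le i z

end Representation

/-! ### Localisation and the interior estimate. -/

section LocalEstimate

theorem laplacian_mul {f g : EuclideanSpace ℝ (Fin n) → ℝ} (hf : ContDiff ℝ 2 f)
    (hg : ContDiff ℝ 2 g) (z : EuclideanSpace ℝ (Fin n)) :
    Laplacian.laplacian (fun y => f y * g y) z =
      f z * Laplacian.laplacian g z +
        2 * ∑ j, fderiv ℝ f z (EuclideanSpace.single j 1) * fderiv ℝ g z (EuclideanSpace.single j 1) +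
        g z * Laplacian.laplacian f z := by
  have hf1 : Differentiable ℝ f := hf.differentiable two_ne_zero
  have hg1 : Differentiable ℝ g := hg.differentiable two_ne_zero
  have key : ∀ v, fderiv ℝ (fderiv ℝ fun y => f y * g y) z v v =
      f z * fderiv ℝ (fderiv ℝ g) z v v + 2 * (fderiv ℝ f z v * fderiv ℝ g z v) +
        g z * fderiv ℝ (fderiv ℝ f) z v v := by
    intro v
    have h1 : (fun y => fderiv ℝ (fun y => f y * g y) y v) =
        fun y => f y * fderiv ℝ g y v + g y * fderiv ℝ f y v := by
      ext y
      rw [fderiv_fun_mul (hf1 y) (hg1 y)]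
      simp
    have hf2 : DifferentiableAt ℝ (fun y => fderiv ℝ f y v) z :=
      (contDiff_fderiv_apply hf v).differentiable one_ne_zero z
    have hg2 : DifferentiableAt ℝ (fun y => fderiv ℝ g y v) z :=
      (contDiff_fderiv_apply hg v).differentiable one_ne_zero z
    rw [← fderiv_fderiv_apply (hf.mul hg), h1, fderiv_fun_add ((hf1 z).fun_mul hg2) ((hg1 z).fun_mul hf2),
      fderiv_fun_mul (hf1 z) hg2, fderiv_fun_mul (hg1 z) hf2, ← fderiv_fderiv_apply hf,
      ← fderiv_fderiv_apply hg]
    simp only [add_apply, smul_apply, smul_eq_mul]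
    ring
  simp_rw [laplacian_eq_sum, key, Finset.sum_add_distrib, Finset.mul_sum]

/-- The derivatives of the cutoff up to order two are bounded by compact support, so `M` depends on
`φ` and not on `ψ`; the interior constant inherits this uniformity. -/
theorem exists_enorm_laplacian_mul_le {φ : EuclideanSpace ℝ (Fin n) → ℝ} (hφ : ContDiff ℝ 2 φ)
    (hc : HasCompactSupport φ) (h1 : ∀ x, φ x ∈ Icc (0 : ℝ) 1) :
    ∃ M : ℝ≥0∞, M ≠ ∞ ∧ ∀ ψ : EuclideanSpace ℝ (Fin n) → ℝ, ContDiff ℝ 2 ψ → ∀ z,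
      ‖Laplacian.laplacian (fun y => φ y * ψ y) z‖ₑ ≤
        M * (‖Laplacian.laplacian ψ z‖ₑ + ‖fderiv ℝ ψ z‖ₑ + ‖ψ z‖ₑ) := by
  obtain ⟨C₁, hC₁⟩ := (hφ.continuous_fderiv two_ne_zero).bounded_above_of_compact_support
    (hc.fderiv ℝ)
  obtain ⟨C₂, hC₂⟩ := ((hφ.fderiv_right (m := 1) (by norm_num)).continuous_fderiv
    one_ne_zero).bounded_above_of_compact_support ((hc.fderiv ℝ).fderiv ℝ)
  have hC₁0 : 0 ≤ C₁ := (norm_nonneg _).trans (hC₁ 0)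
  have hC₂0 : 0 ≤ C₂ := (norm_nonneg _).trans (hC₂ 0)
  have hs : ∀ j : Fin n, ‖(EuclideanSpace.single j 1 : EuclideanSpace ℝ (Fin n))‖ = 1 := by simp
  refine ⟨ENNReal.ofReal (1 + 2 * n * C₁ + n * C₂), ENNReal.ofReal_ne_top, fun ψ hψ z => ?_⟩
  have hΔ : ‖Laplacian.laplacian φ z‖ ≤ n * C₂ := by
    rw [laplacian_eq_sum]
    refine (norm_sum_le_of_le _ (fun j _ => ?_) (n := fun _ => C₂)).trans (by simp)
    refine (ContinuousLinearMap.le_opNorm₂ _ _ _).trans ?_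
    rw [hs, mul_one, mul_one]
    exact hC₂ z
  have hgrad : ‖∑ j, fderiv ℝ φ z (EuclideanSpace.single j 1) *
      fderiv ℝ ψ z (EuclideanSpace.single j 1)‖ ≤ n * (C₁ * ‖fderiv ℝ ψ z‖) := by
    refine (norm_sum_le_of_le _ (fun j _ => ?_) (n := fun _ => C₁ * ‖fderiv ℝ ψ z‖)).trans
      (by simp)
    rw [norm_mul]
    gcongr
    · refine (ContinuousLinearMap.le_opNorm _ _).trans ?_
      rw [hs, mul_one]
      exact hC₁ z
    · refine (ContinuousLinearMap.le_opNorm _ _).trans ?_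
      rw [hs, mul_one]
  have hφz : ‖φ z‖ ≤ 1 := by
    rw [Real.norm_of_nonneg (h1 z).1]; exact (h1 z).2
  rw [← ofReal_norm, ← ofReal_norm, ← ofReal_norm, ← ofReal_norm,
    ← ENNReal.ofReal_add (norm_nonneg _) (norm_nonneg _),
    ← ENNReal.ofReal_add (by positivity) (norm_nonneg _), ← ENNReal.ofReal_mul (by positivity)]
  refine ENNReal.ofReal_le_ofReal ?_
  rw [laplacian_mul hφ hψ]
  refine norm_add₃_le.trans ?_
  rw [norm_mul, norm_mul, norm_mul, Real.norm_of_nonneg (zero_le_two (α := ℝ))]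
  calc _ ≤ 1 * ‖Laplacian.laplacian ψ z‖ + 2 * (n * (C₁ * ‖fderiv ℝ ψ z‖)) +
        ‖ψ z‖ * (n * C₂) := by gcongr
    _ ≤ _ := by
      have h2 := norm_nonneg (Laplacian.laplacian ψ z)
      have h3 := norm_nonneg (fderiv ℝ ψ z)
      have h4 := norm_nonneg (ψ z)
      have h5 : 0 ≤ n * C₂ := by positivity
      have h6 : 0 ≤ n * C₁ := by positivity
      nlinarith [mul_nonneg h5 h2, mul_nonneg h5 h3, mul_nonneg h6 h2, mul_nonneg h6 h4]

/-- Interpolation between `L^∞` and `L¹`: the near kernel meets the bound `1`, the far kernel the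
bound `d` on the integral, and the radius `d^{1/n}` balances the two. -/
theorem rieszPotential_le_of_le_one (hn : 2 ≤ n) {h : EuclideanSpace ℝ (Fin n) → ℝ≥0∞}
    (hm : Measurable h) (h1 : ∀ y, h y ≤ 1) {d : ℝ} (hd : 0 < d)
    (hint : ∫⁻ y, h y ≤ ENNReal.ofReal d) (x : EuclideanSpace ℝ (Fin n)) :
    rieszPotential h x ≤ ENNReal.ofReal (rieszMass n + 1) * ENNReal.ofReal (d ^ (1 / (n : ℝ))) := by
  have hn0 : (0 : ℝ) < n := by positivity
  have hr : 0 < d ^ (1 / (n : ℝ)) := by positivity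
  calc rieszPotential h x
      ≤ ∫⁻ y, (nearKernel (d ^ (1 / (n : ℝ))) (x - y) +
          h y * ENNReal.ofReal ((d ^ (1 / (n : ℝ))) ^ (1 - (n : ℝ)))) := by
        refine lintegral_mono fun y => ?_
        refine (mul_le_mul_right (rieszKernel_le hn hr (x - y)) _).trans ?_
        rw [mul_add]
        gcongr
        exact mul_le_of_le_one_left zero_le (h1 y)
    _ ≤ ENNReal.ofReal (d ^ (1 / (n : ℝ)) * rieszMass n) +
        ENNReal.ofReal d * ENNReal.ofReal ((d ^ (1 / (n : ℝ))) ^ (1 - (n : ℝ))) := by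
        rw [lintegral_add_right _ (hm.mul_const _), lintegral_nearKernel_sub_left hn hr,
          lintegral_mul_const _ hm]
        gcongr
    _ = _ := by
        rw [← ENNReal.ofReal_mul hd.le,
          ← ENNReal.ofReal_add (mul_nonneg hr.le rieszMass_nonneg) (by positivity),
          ← ENNReal.ofReal_mul (add_nonneg rieszMass_nonneg zero_le_one)]
        congr 1
        have : d * (d ^ (1 / (n : ℝ))) ^ (1 - (n : ℝ)) = d ^ (1 / (n : ℝ)) := by
          rw [← Real.rpow_mul hd.le]
          nth_rewrite 1 [← Real.rpow_one d]
          rw [← Real.rpow_add hd]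
          congr 1
          field_simp
          ring
        rw [this]; ring

theorem exists_cutoff {ω ω' : Set (EuclideanSpace ℝ (Fin n))} (hω : IsCompact (closure ω))
    (hω' : IsOpen ω') (h : closure ω ⊆ ω') :
    ∃ φ : EuclideanSpace ℝ (Fin n) → ℝ, ContDiff ℝ 2 φ ∧ HasCompactSupport φ ∧ tsupport φ ⊆ ω' ∧
      (∀ x, φ x ∈ Icc (0 : ℝ) 1) ∧ ∀ᶠ x in 𝓝ˢ (closure ω), φ x = 1 := by
  obtain ⟨W, hWo, hKW, hWU, hWc⟩ := exists_open_between_and_isCompact_closure hω hω' h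
  obtain ⟨f, hf1, hf0, hf⟩ := exists_contMDiffMap_one_nhds_of_subset_interior (n := 2)
    (modelWithCornersSelf ℝ (EuclideanSpace ℝ (Fin n))) isClosed_closure
    (hKW.trans (interior_maximal subset_closure hWo))
  have hsub : tsupport f ⊆ closure W :=
    closure_minimal (fun x hx => by_contra fun h => hx (hf0 x h)) isClosed_closure
  exact ⟨f, f.contMDiff.contDiff, hWc.of_isClosed_subset (isClosed_tsupport _) hsub,
    hsub.trans hWU, hf, hf1⟩

theorem enorm_fderiv_le_sum (u : EuclideanSpace ℝ (Fin n) → ℝ) (x : EuclideanSpace ℝ (Fin n)) :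
    ‖fderiv ℝ u x‖ₑ ≤ ∑ i, ‖fderiv ℝ u x (EuclideanSpace.single i 1)‖ₑ := by
  have : ‖fderiv ℝ u x‖ ≤ ∑ i, ‖fderiv ℝ u x (EuclideanSpace.single i 1)‖ := by
    refine ContinuousLinearMap.opNorm_le_bound _ (by positivity) fun v => ?_
    have hv : v = ∑ i, v i • EuclideanSpace.single i (1 : ℝ) := by
      simpa using ((EuclideanSpace.basisFun (Fin n) ℝ).sum_repr v).symm
    conv_lhs => rw [hv]
    rw [map_sum, Finset.sum_mul]
    refine norm_sum_le_of_le _ fun i _ => ?_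
    rw [map_smul, norm_smul, mul_comm]
    gcongr
    exact PiLp.norm_apply_le v i
  rw [← ofReal_norm]
  refine (ENNReal.ofReal_le_ofReal this).trans ?_
  rw [ENNReal.ofReal_sum_of_nonneg fun _ _ => norm_nonneg _]
  simp only [ofReal_norm, le_refl]

theorem rieszPotential_mono_ae {f g : EuclideanSpace ℝ (Fin n) → ℝ≥0∞}
    (h : ∀ᵐ y ∂volume, f y ≤ g y) (x : EuclideanSpace ℝ (Fin n)) :
    rieszPotential f x ≤ rieszPotential g x :=
  lintegral_mono_ae (h.mono fun _ hy => mul_le_mul_left hy _)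

theorem laplacian_eq_zero_of_notMem_tsupport {u : EuclideanSpace ℝ (Fin n) → ℝ}
    {y : EuclideanSpace ℝ (Fin n)} (h : y ∉ tsupport u) : Laplacian.laplacian u y = 0 := by
  have h0 : u =ᶠ[𝓝 y] fun _ => 0 := notMem_tsupport_iff_eventuallyEq.1 h
  rw [(InnerProductSpace.laplacian_congr_nhds h0).self_of_nhds]
  simp

/-- The interior estimate: if `|∇ψ| ≤ ε √V` and `|Δψ| ≤ ε V` near `ω`, and `ψ` is small in `L¹`,
then `ψ` is uniformly small on `ω` and its gradient is small in `L^{n,1}(ω)`. -/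
theorem exists_interior_estimate (hn : 2 ≤ n) {O ω : Set (EuclideanSpace ℝ (Fin n))}
    (hO : IsOpen O) (hω : CompactlyContained ω O) {V : EuclideanSpace ℝ (Fin n) → ℝ≥0∞}
    (hV : MemLorentzLoc ((n : ℝ) / 2) 1 O V) :
    ∃ C : ℝ≥0∞, C ≠ ∞ ∧ ∀ ψ : EuclideanSpace ℝ (Fin n) → ℝ, ContDiff ℝ 2 ψ →
      (∀ x, 0 ≤ ψ x ∧ ψ x ≤ 1) → ∀ (ε : ℝ≥0∞) (d : ℝ), ε ≠ ∞ → 0 < d →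
      (∀ᵐ y ∂volume, y ∈ O → ‖fderiv ℝ ψ y‖ₑ ≤ ε * V y ^ (1 / 2 : ℝ)) →
      (∀ᵐ y ∂volume, y ∈ O → ‖Laplacian.laplacian ψ y‖ₑ ≤ ε * V y) →
      ∫⁻ y in O, ‖ψ y‖ₑ ≤ ENNReal.ofReal d →
      (∀ x ∈ closure ω, ‖ψ x‖ₑ ≤ C * (ε + ENNReal.ofReal (d ^ (1 / (n : ℝ))))) ∧
      lorentzIntegral (n : ℝ) ω (fun x => ‖fderiv ℝ ψ x‖ₑ) ≤
        C * (ε + ENNReal.ofReal (d ^ (1 / (n : ℝ)))) := by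
  have hn0 : (0 : ℝ) < n := by positivity
  obtain ⟨ω', hω'o, hωω', hω'O, hω'c⟩ := exists_open_between_and_isCompact_closure hω.2.1 hO hω.2.2
  have hω'f : volume ω' ≠ ∞ := ((measure_mono subset_closure).trans_lt hω'c.measure_lt_top).ne
  have hω'm : MeasurableSet ω' := hω'o.measurableSet
  obtain ⟨φ, hφ, hφc, hφs, hφ01, hφ1⟩ := exists_cutoff hω.2.1 hω'o hωω'
  obtain ⟨M, hM, hlap⟩ := exists_enorm_laplacian_mul_le hφ hφc hφ01
  obtain ⟨hVm, hVL⟩ := hV ω' ⟨hω'o, hω'c, hω'O⟩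
  rw [lorentzNorm_one_lt_top_iff hω'f] at hVL
  set V' := hVm.mk V with hV'
  have hV'm : Measurable V' := hVm.measurable_mk
  have hVV' : ∀ᵐ y ∂volume, y ∈ ω' → V y = V' y := (ae_restrict_iff' hω'm).1 hVm.ae_eq_mk
  -- Adding `1` makes `g` dominate both `V` and `√V`, so one function controls `Δψ` and `∇ψ`. It
  -- stays in `L^{n/2,1}` because `ω'` has finite measure.
  set g : EuclideanSpace ℝ (Fin n) → ℝ≥0∞ := fun y => V' y + 1 with hg_def
  have hg : Measurable g := hV'm.add_const 1
  have hgL : lorentzIntegral ((n : ℝ) / 2) ω' g < ∞ := by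
    refine (lorentzIntegral_add_const (by positivity) 1).trans_lt ?_
    refine ENNReal.add_lt_top.2 ⟨lt_of_le_of_lt ?_ hVL,
      ENNReal.mul_lt_top ENNReal.ofReal_lt_top ENNReal.one_lt_top⟩
    exact lorentzIntegral_mono subset_rfl hω'f (hVV'.mono fun y hy h => (hy h).ge)
  set Tg := rieszPotential (ω'.indicator g) with hTg_def
  have hTg : Measurable Tg := measurable_rieszPotential (hg.indicator hω'm)
  have hTgL : lorentzIntegral (n : ℝ) ω' Tg < ∞ :=
    (lorentzIntegral_rieszPotential_le hn hω'm hω'f hg).trans_lt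
      (ENNReal.mul_lt_top ENNReal.ofReal_lt_top (ENNReal.mul_lt_top (by simp) hgL))
  set Λ := lorentzIntegral (n : ℝ) ω' Tg with hΛ
  set a : ℝ≥0∞ := ENNReal.ofReal (rieszMass n + 1) with ha
  set c : ℝ≥0∞ := (ENNReal.ofReal (divMass n))⁻¹ with hc
  have hmass0 : ENNReal.ofReal (divMass n) ≠ 0 := by simpa using divMass_pos hn
  have hcf : c ≠ ∞ := ENNReal.inv_ne_top.2 hmass0
  set W : ℝ≥0∞ := ENNReal.ofReal ((volume ω').toReal ^ (1 / (n : ℝ)) / (1 / (n : ℝ))) with hW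
  -- Here `n` counts the partial derivatives, `c` normalises the representation formula, `M` comes
  -- from the cutoff, `2` from the two terms controlled by `ε g`, and `a` from the potential of
  -- `|ψ|`.
  set b : ℝ≥0∞ := n * (c * (M * (2 + a))) with hb
  have hbf : b ≠ ∞ := by
    refine ENNReal.mul_ne_top (by simp) (ENNReal.mul_ne_top hcf (ENNReal.mul_ne_top hM ?_))
    exact ENNReal.add_ne_top.2 ⟨by simp, ENNReal.ofReal_ne_top⟩
  set C₀ : ℝ≥0∞ := b * (Λ + W) with hC₀
  have hC₀f : C₀ ≠ ∞ :=
    ENNReal.mul_ne_top hbf (ENNReal.add_ne_top.2 ⟨hTgL.ne, ENNReal.ofReal_ne_top⟩)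
  -- The first summand serves the uniform bound and the second the gradient bound.
  refine ⟨c * (n * (a * C₀)) + C₀, ENNReal.add_ne_top.2 ⟨ENNReal.mul_ne_top hcf
    (ENNReal.mul_ne_top (by simp) (ENNReal.mul_ne_top ENNReal.ofReal_ne_top hC₀f)), hC₀f⟩, ?_⟩
  intro ψ hψ hψ01 ε d hε hd hgrad hlapψ hL1
  set τ : ℝ≥0∞ := ENNReal.ofReal (d ^ (1 / (n : ℝ))) with hτ
  set u : EuclideanSpace ℝ (Fin n) → ℝ := fun y => φ y * ψ y with hu_def
  have hu : ContDiff ℝ 2 u := hφ.mul hψ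
  have huc : HasCompactSupport u := hφc.mul_right
  have hus : tsupport u ⊆ ω' := (tsupport_mul_subset_left).trans hφs
  set h : EuclideanSpace ℝ (Fin n) → ℝ≥0∞ := ω'.indicator fun y => ‖ψ y‖ₑ with hh_def
  have hhm : Measurable h := (hψ.continuous.measurable.enorm).indicator hω'm
  have hh1 : ∀ y, h y ≤ 1 := by
    intro y
    refine (indicator_le_self _ _ y).trans ?_
    rw [Real.enorm_of_nonneg (hψ01 y).1]
    exact ENNReal.ofReal_le_one.2 (hψ01 y).2
  have hhint : ∫⁻ y, h y ≤ ENNReal.ofReal d := by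
    rw [hh_def, lintegral_indicator hω'm]
    exact (lintegral_mono_set (subset_closure.trans hω'O)).trans hL1
  have hΔu : ∀ᵐ y ∂volume, ‖Laplacian.laplacian u y‖ₑ ≤
      (2 * M * ε) * ω'.indicator g y + M * h y := by
    filter_upwards [hgrad, hlapψ, hVV'] with y h1 h2 h3
    by_cases hy : y ∈ ω'
    · have hyO : y ∈ O := hω'O (subset_closure hy)
      refine (hlap ψ hψ y).trans ?_
      rw [indicator_of_mem hy, hh_def, indicator_of_mem hy]
      specialize h1 hyO
      specialize h2 hyO
      rw [h3 hy] at h1 h2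
      have hsqrt : V' y ^ (1 / 2 : ℝ) ≤ g y := by
        rcases le_total (V' y) 1 with hv | hv
        · exact (ENNReal.rpow_le_one hv (by norm_num)).trans le_add_self
        · refine le_trans ?_ (le_self_add : V' y ≤ V' y + 1)
          simpa using ENNReal.rpow_le_rpow_of_exponent_le hv (by norm_num : (1 / 2 : ℝ) ≤ 1)
      calc _ ≤ M * (ε * g y + ε * g y + ‖ψ y‖ₑ) := by
            gcongr
            · exact h2.trans (by gcongr; exact le_self_add)
            · exact h1.trans (by gcongr)
        _ = _ := by ring
    · rw [laplacian_eq_zero_of_notMem_tsupport fun h => hy (hus h)]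
      simp
  have hTΔ : ∀ x, rieszPotential (fun y => ‖Laplacian.laplacian u y‖ₑ) x ≤
      M * (2 + a) * (ε * Tg x + τ) := by
    intro x
    have hK : Measurable fun y => rieszKernel (x - y) :=
      measurable_rieszKernel.comp (measurable_const.sub measurable_id)
    calc _ ≤ rieszPotential (fun y => (2 * M * ε) * ω'.indicator g y + M * h y) x :=
          rieszPotential_mono_ae hΔu x
      _ = (2 * M * ε) * Tg x + M * rieszPotential h x := by
          simp only [rieszPotential, add_mul, mul_assoc, hTg_def]
          have hhK : Measurable fun y => M * (h y * rieszKernel (x - y)) :=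
            (hhm.mul hK).const_mul M
          rw [lintegral_add_right _ hhK, lintegral_const_mul' _ _ ENNReal.ofNat_ne_top,
            lintegral_const_mul' _ _ hM, lintegral_const_mul' _ _ hM,
            lintegral_const_mul' _ _ hε]
      _ ≤ (2 * M * ε) * Tg x + M * (a * τ) := by
          gcongr
          exact rieszPotential_le_of_le_one hn hhm hh1 hd hhint x
      _ ≤ M * (2 + a) * (ε * Tg x + τ) := by
          have : M * (2 + a) * (ε * Tg x + τ) =
            ((2 * M * ε) * Tg x + M * (a * τ)) + (M * a * (ε * Tg x) + M * 2 * τ) := by ring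
          rw [this]
          exact le_self_add
  have hDu : ∀ x, ‖fderiv ℝ u x‖ₑ ≤ b * ε * Tg x + b * τ := by
    intro x
    refine (enorm_fderiv_le_sum u x).trans ?_
    calc _ ≤ ∑ _i : Fin n, c * (M * (2 + a) * (ε * Tg x + τ)) := by
          refine Finset.sum_le_sum fun i _ => ?_
          rw [hc, ← ENNReal.div_eq_inv_mul,
            ENNReal.le_div_iff_mul_le (.inl hmass0) (.inl ENNReal.ofReal_ne_top), mul_comm]
          exact (enorm_fderiv_le_rieszPotential_laplacian hu huc x i).trans (hTΔ x)
      _ = _ := by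
          rw [Finset.sum_const, Finset.card_univ, Fintype.card_fin, nsmul_eq_mul, hb]
          ring
  have hbound : lorentzIntegral (n : ℝ) ω' (fun x => b * ε * Tg x + b * τ) ≤ C₀ * (ε + τ) := by
    refine (lorentzIntegral_add_const hn0 _).trans ?_
    calc _ ≤ b * ε * Λ + W * (b * τ) := by
          gcongr
          exact lorentzIntegral_const_mul (ENNReal.mul_ne_top hbf hε)
      _ ≤ _ := by
          have : C₀ * (ε + τ) = (b * ε * Λ + W * (b * τ)) + (b * W * ε + b * Λ * τ) := by
            rw [hC₀]; ring
          rw [this]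
          exact le_self_add
  have hψu : ∀ x ∈ closure ω, ψ =ᶠ[𝓝 x] u := by
    intro x hx
    filter_upwards [eventually_nhdsSet_iff_forall.1 hφ1 x hx] with y hy
    rw [hu_def]
    simp [hy]
  constructor
  · intro x hx
    rw [(hψu x hx).self_of_nhds]
    -- Second use of the potential: the `L^{n,1}` majorant of `∇u` is fed into the map from
    -- `L^{n,1}` to `L^∞`. Off `ω'` the derivative vanishes, so the majorant is needed only there.
    have h1 : ‖u x‖ₑ ≤ c * (n * (a * (C₀ * (ε + τ)))) := by
      rw [hc, ← ENNReal.div_eq_inv_mul,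
        ENNReal.le_div_iff_mul_le (.inl hmass0) (.inl ENNReal.ofReal_ne_top), mul_comm]
      refine (enorm_le_rieszPotential_fderiv (hu.of_le one_le_two) huc x).trans ?_
      gcongr
      refine le_trans ?_ ((rieszPotential_le_lorentzIntegral hn hω'm hω'f
        ((hTg.const_mul (b * ε)).add_const (b * τ)) x).trans (mul_le_mul_right hbound a))
      refine rieszPotential_mono_ae (Eventually.of_forall fun y => ?_) x
      by_cases hy : y ∈ ω'
      · rw [indicator_of_mem hy]
        exact hDu y
      · have : fderiv ℝ u y = 0 := by
          by_contra hne
          exact hy (hus (support_fderiv_subset ℝ hne))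
        rw [this, ← ofReal_norm, norm_zero, ENNReal.ofReal_zero]
        exact zero_le
    refine h1.trans ?_
    rw [add_mul]
    refine le_add_right (le_of_eq ?_)
    ring
  · have h1 : lorentzIntegral (n : ℝ) ω (fun x => ‖fderiv ℝ ψ x‖ₑ) ≤ C₀ * (ε + τ) := by
      refine le_trans (lorentzIntegral_mono (subset_closure.trans hωω') hω'f
        (Eventually.of_forall fun x hx => ?_)) hbound
      rw [(hψu x (subset_closure hx)).fderiv_eq]
      exact hDu x
    refine h1.trans ?_
    rw [add_mul]
    exact le_add_self

end LocalEstimate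

/-! ### Power functions in Lorentz spaces. -/

section PowerFunction

theorem lintegral_Ioo_rpow_eq_top {s t : ℝ} (ht : 0 < t) (hs : s ≤ -1) :
    ∫⁻ x in Ioo 0 t, ENNReal.ofReal (x ^ s) = ∞ := by
  by_contra h
  have hint : IntegrableOn (fun x : ℝ => x ^ s) (Ioo 0 t) := by
    refine (lintegral_ofReal_ne_top_iff_integrable ?_ ?_).1 h
    · exact (by fun_prop : Measurable fun x : ℝ => x ^ s).aestronglyMeasurable
    · exact (ae_restrict_mem measurableSet_Ioo).mono fun x hx => Real.rpow_nonneg hx.1.le _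
  have := (intervalIntegral.integrableOn_Ioo_rpow_iff ht).1 hint
  linarith

/-- The volume of the unit ball. -/
def unitBallVolume (n : ℕ) : ℝ :=
  volume.real (Metric.ball (0 : EuclideanSpace ℝ (Fin n)) 1)

theorem unitBallVolume_pos : 0 < unitBallVolume n :=
  ENNReal.toReal_pos (Metric.measure_ball_pos _ _ one_pos).ne' measure_ball_lt_top.ne

theorem volume_ball_eq (a : EuclideanSpace ℝ (Fin n)) {r : ℝ} (hr : 0 ≤ r) (hn : n ≠ 0) :
    volume (Metric.ball a r) = ENNReal.ofReal (r ^ n * unitBallVolume n) := by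
  have : Nontrivial (EuclideanSpace ℝ (Fin n)) :=
    Module.nontrivial_of_finrank_pos (R := ℝ) (by rw [finrank_euclideanSpace_fin]; lia)
  rw [Measure.addHaar_ball _ _ hr, finrank_euclideanSpace_fin, unitBallVolume,
    ENNReal.ofReal_mul (by positivity), ofReal_measureReal measure_ball_lt_top.ne]

/-- The radius of the ball of measure `s`. -/
def ballRadius (n : ℕ) (s : ℝ) : ℝ :=
  (s / unitBallVolume n) ^ (1 / (n : ℝ))

theorem ballRadius_pos {s : ℝ} (hs : 0 < s) : 0 < ballRadius n s :=
  Real.rpow_pos_of_pos (div_pos hs unitBallVolume_pos) _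

theorem ballRadius_pow {s : ℝ} (hs : 0 < s) (hn : n ≠ 0) :
    ballRadius n s ^ n * unitBallVolume n = s := by
  have h := div_pos hs (unitBallVolume_pos (n := n))
  rw [ballRadius, ← Real.rpow_natCast, ← Real.rpow_mul h.le, one_div_mul_cancel (by simpa using hn),
    Real.rpow_one, div_mul_cancel₀ _ unitBallVolume_pos.ne']

theorem ballRadius_rpow {s : ℝ} (hs : 0 < s) (m : ℝ) :
    ballRadius n s ^ (-m) = unitBallVolume n ^ (m / n) * s ^ (-(m / n)) := by
  have h := div_pos hs (unitBallVolume_pos (n := n))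
  have e : 1 / (n : ℝ) * -m = -(m / n) := by ring
  rw [ballRadius, ← Real.rpow_mul h.le, e, Real.div_rpow hs.le unitBallVolume_pos.le,
    Real.rpow_neg unitBallVolume_pos.le, div_inv_eq_mul, mul_comm]

/-- The power can exceed its value on the sphere of radius `ballRadius n s` only inside the
corresponding ball, whose measure is exactly `s`. -/
theorem rearrangement_norm_rpow_le (hn : n ≠ 0) (D : Set (EuclideanSpace ℝ (Fin n)))
    (a : EuclideanSpace ℝ (Fin n)) {m s : ℝ} (hm : 0 ≤ m) (hs : 0 < s) :
    rearrangement D (fun x => ‖x - a‖ₑ ^ (-m)) s ≤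
      ENNReal.ofReal (unitBallVolume n ^ (m / n) * s ^ (-(m / n))) := by
  have hr := ballRadius_pos (n := n) hs
  rw [← ballRadius_rpow hs, rearrangement_le_iff]
  refine le_trans (measure_mono ?_) ((volume_ball_eq a hr.le hn).trans_le
    (by rw [ballRadius_pow hs hn]))
  rintro x ⟨-, hx⟩
  by_contra hxb
  have hle : ballRadius n s ≤ ‖x - a‖ := by simpa [dist_eq_norm] using hxb
  refine absurd hx (not_lt.2 ?_)
  beta_reduce
  rw [← ofReal_norm, ENNReal.ofReal_rpow_of_pos (hr.trans_le hle)]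
  exact ENNReal.ofReal_le_ofReal (Real.rpow_le_rpow_of_nonpos hr hle (by linarith))

/-- Doubling the radius gives a ball of measure `2^n s`, strictly more than `s`, as the strict
criterion for the rearrangement requires. The price is the factor `2^{-m}`. -/
theorem le_rearrangement_norm_rpow (hn : n ≠ 0) {D : Set (EuclideanSpace ℝ (Fin n))}
    {a : EuclideanSpace ℝ (Fin n)} {m s : ℝ} (hm : 0 < m) (hs : 0 < s)
    (hD : Metric.ball a (2 * ballRadius n s) ⊆ D) :
    ENNReal.ofReal (2 ^ (-m) * (unitBallVolume n ^ (m / n) * s ^ (-(m / n)))) ≤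
      rearrangement D (fun x => ‖x - a‖ₑ ^ (-m)) s := by
  have hr := ballRadius_pos (n := n) hs
  rw [← ballRadius_rpow hs, ← Real.mul_rpow zero_le_two hr.le]
  refine le_of_lt (lt_rearrangement_iff.2 ?_)
  calc ENNReal.ofReal s < volume (Metric.ball a (2 * ballRadius n s)) := by
        rw [volume_ball_eq a (by positivity) hn, mul_pow, mul_assoc, ballRadius_pow hs hn,
          ENNReal.ofReal_lt_ofReal_iff (by positivity)]
        exact lt_mul_of_one_lt_left hs (one_lt_pow₀ one_lt_two hn)
    _ ≤ _ := by
        refine measure_mono fun x hx => ⟨hD hx, ?_⟩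
        have hlt : ‖x - a‖ < 2 * ballRadius n s := by simpa [dist_eq_norm] using hx
        rcases eq_or_ne x a with rfl | hxa
        · simp [ENNReal.zero_rpow_of_neg (neg_lt_zero.2 hm)]
        have hpos : 0 < ‖x - a‖ := norm_pos_iff.2 (sub_ne_zero.2 hxa)
        beta_reduce
        rw [← ofReal_norm, ENNReal.ofReal_rpow_of_pos hpos,
          ENNReal.ofReal_lt_ofReal_iff (by positivity)]
        exact Real.rpow_lt_rpow_of_neg hpos hlt (by linarith)

/-- The inner integral of `s^{-m/n}` converges since `m < 2 ≤ n`; the outer integrand is then a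
multiple of `t^{(2-m)/n - 1}`, integrable at `0` because `m < 2`. -/
theorem lorentzIntegral_norm_rpow_lt_top (hn : 2 ≤ n) (D : Set (EuclideanSpace ℝ (Fin n)))
    (a : EuclideanSpace ℝ (Fin n)) {m : ℝ} (hm : 0 ≤ m) (hm2 : m < 2) :
    lorentzIntegral ((n : ℝ) / 2) D (fun x => ‖x - a‖ₑ ^ (-m)) < ∞ := by
  have hn2 : (2 : ℝ) ≤ n := by exact_mod_cast hn
  have hn0 : (0 : ℝ) < n := by linarith
  have hκ := unitBallVolume_pos (n := n)
  have hq : 0 < 1 - m / n := by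
    rw [sub_pos, div_lt_one hn0]; linarith
  have hq' : 0 < (2 - m) / n := div_pos (by linarith) hn0
  set c := unitBallVolume n ^ (m / n) / (1 - m / n) with hc
  have hc0 : 0 ≤ c := by positivity
  calc _ ≤ ∫⁻ t in Ioo 0 (volume D).toReal,
        ENNReal.ofReal c * ENNReal.ofReal (t ^ ((2 - m) / n - 1)) := by
        refine setLIntegral_mono' measurableSet_Ioo fun t ht => ?_
        have ht0 : 0 < t := ht.1
        have hinner : ∫⁻ s in Ioo 0 t, rearrangement D (fun x => ‖x - a‖ₑ ^ (-m)) s ≤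
            ENNReal.ofReal (c * t ^ (1 - m / n)) := by
          calc _ ≤ ∫⁻ s in Ioo 0 t, ENNReal.ofReal (unitBallVolume n ^ (m / n)) *
                ENNReal.ofReal (s ^ (1 - m / n - 1)) := by
                refine setLIntegral_mono' measurableSet_Ioo fun s hs => ?_
                rw [← ENNReal.ofReal_mul (by positivity)]
                refine (rearrangement_norm_rpow_le (by lia) D a hm hs.1).trans_eq ?_
                congr 3
                ring
            _ = _ := by
                rw [lintegral_const_mul _ (by fun_prop), lintegral_Ioo_rpow hq ht0.le,
                  ← ENNReal.ofReal_mul (by positivity), hc]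
                congr 1
                ring
        refine (mul_le_mul_right hinner _).trans_eq ?_
        rw [← ENNReal.ofReal_mul (by positivity), ← ENNReal.ofReal_mul hc0, mul_left_comm,
          ← Real.rpow_add ht0]
        congr 3
        field_simp
        ring
    _ < ∞ := by
        rw [lintegral_const_mul _ (by fun_prop), lintegral_Ioo_rpow hq' ENNReal.toReal_nonneg]
        exact ENNReal.mul_lt_top ENNReal.ofReal_lt_top ENNReal.ofReal_lt_top

theorem lorentzIntegral_norm_rpow_eq_top (hn : 2 ≤ n) {D : Set (EuclideanSpace ℝ (Fin n))}
    (hD : IsOpen D) (hDf : volume D ≠ ∞) {a : EuclideanSpace ℝ (Fin n)} (ha : a ∈ D) {m : ℝ}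
    (hm : 2 ≤ m) :
    lorentzIntegral ((n : ℝ) / 2) D (fun x => ‖x - a‖ₑ ^ (-m)) = ∞ := by
  have hn0 : (0 : ℝ) < n := by positivity
  have hκ := unitBallVolume_pos (n := n)
  obtain ⟨r, hr, hrD⟩ := Metric.isOpen_iff.1 hD a ha
  -- The measure of the ball of radius `r / 2`: for `s < T` the doubled ball still lies in `D`.
  set T := (r / 2) ^ n * unitBallVolume n with hT
  have hT0 : 0 < T := by positivity
  have hTD : T ≤ (volume D).toReal := by
    rw [← ENNReal.ofReal_le_iff_le_toReal hDf, hT,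
      ← volume_ball_eq a (by positivity) (by lia)]
    exact measure_mono ((Metric.ball_subset_ball (by linarith)).trans hrD)
  have hrad : ∀ s, 0 < s → s < T → Metric.ball a (2 * ballRadius n s) ⊆ D := by
    intro s hs hsT
    refine (Metric.ball_subset_ball ?_).trans hrD
    have h1 : ballRadius n s ^ n < (r / 2) ^ n := by
      rw [← ballRadius_pow hs (by lia : n ≠ 0), hT] at hsT
      exact lt_of_mul_lt_mul_right hsT hκ.le
    have := lt_of_pow_lt_pow_left₀ n (by positivity) h1
    linarith
  set c := 2 ^ (-m) * unitBallVolume n ^ (m / n) with hc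
  have hc0 : 0 < c := by positivity
  have hex : (2 - m) / n - 1 ≤ -1 := by
    have : (2 - m) / n ≤ 0 := div_nonpos_of_nonpos_of_nonneg (by linarith) hn0.le
    linarith
  rw [eq_top_iff]
  calc ∞ = ENNReal.ofReal c * ∫⁻ t in Ioo 0 T, ENNReal.ofReal (t ^ ((2 - m) / n - 1)) := by
        rw [lintegral_Ioo_rpow_eq_top hT0 hex, ENNReal.mul_top (by simpa using hc0)]
    _ = ∫⁻ t in Ioo 0 T, ENNReal.ofReal c * ENNReal.ofReal (t ^ ((2 - m) / n - 1)) := by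
        rw [lintegral_const_mul _ (by fun_prop)]
    _ ≤ ∫⁻ t in Ioo 0 T, ENNReal.ofReal (t ^ (1 / ((n : ℝ) / 2) - 2)) *
          ∫⁻ s in Ioo 0 t, rearrangement D (fun x => ‖x - a‖ₑ ^ (-m)) s := by
        refine setLIntegral_mono' measurableSet_Ioo fun t ht => ?_
        have ht0 : 0 < t := ht.1
        -- Monotonicity gives `∫₀ᵗ u_* ≥ t u_*(t)`, which avoids treating separately the case `m ≥
        -- n`, where the inner integral itself diverges.
        have hinner : ENNReal.ofReal (c * t ^ (-(m / n)) * t) ≤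
            ∫⁻ s in Ioo 0 t, rearrangement D (fun x => ‖x - a‖ₑ ^ (-m)) s := by
          calc _ = ∫⁻ s in Ioo 0 t, ENNReal.ofReal (c * t ^ (-(m / n))) := by
                rw [setLIntegral_const, Real.volume_Ioo, sub_zero,
                  ENNReal.ofReal_mul (by positivity)]
            _ ≤ _ := by
                refine setLIntegral_mono' measurableSet_Ioo fun s hs => ?_
                refine le_trans ?_ (rearrangement_antitone hs.2.le)
                rw [hc, mul_assoc]
                exact le_rearrangement_norm_rpow (by lia) (by linarith) ht0 (hrad t ht0 ht.2)
        refine le_trans (le_of_eq ?_) (mul_le_mul_right hinner _)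
        rw [← ENNReal.ofReal_mul hc0.le, ← ENNReal.ofReal_mul (by positivity)]
        congr 1
        have : t ^ ((2 - m) / n - 1) = t ^ (1 / ((n : ℝ) / 2) - 2) * (t ^ (-(m / n)) * t ^ (1 : ℝ)) := by
          rw [← Real.rpow_add ht0, ← Real.rpow_add ht0]
          congr 1
          field_simp
          ring
        rw [this, Real.rpow_one]
        ring
    _ ≤ _ := lintegral_mono_set (Ioo_subset_Ioo_right hTD)

theorem memLorentz_norm_rpow_iff (hn : 2 ≤ n) {D : Set (EuclideanSpace ℝ (Fin n))}
    (hD : IsOpen D) (hDb : Bornology.IsBounded D) {a : EuclideanSpace ℝ (Fin n)} (ha : a ∈ D)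
    (m : ℝ) : MemLorentz ((n : ℝ) / 2) 1 D (fun x => ‖x - a‖ₑ ^ (-m)) ↔ m < 2 := by
  have hn0 : (0 : ℝ) < n := by positivity
  have hDf : volume D ≠ ∞ := hDb.measure_lt_top.ne
  rw [MemLorentz, lorentzNorm_one_lt_top_iff hDf]
  constructor
  · rintro ⟨-, h⟩
    by_contra! hm
    exact h.ne (lorentzIntegral_norm_rpow_eq_top hn hD hDf ha hm)
  · intro hm
    refine ⟨(by fun_prop : Measurable fun x : EuclideanSpace ℝ (Fin n) =>
      ‖x - a‖ₑ ^ (-m)).aemeasurable, ?_⟩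
    rcases le_or_gt 0 m with h0 | h0
    · exact lorentzIntegral_norm_rpow_lt_top hn D a h0 hm
    · obtain ⟨R, hR⟩ := hDb.subset_closedBall a
      set c := ENNReal.ofReal R ^ (-m) with hc
      have hcf : c ≠ ∞ := ENNReal.rpow_ne_top_of_nonneg (by linarith) ENNReal.ofReal_ne_top
      -- For `m < 0` the function is bounded on `D`. The constant is written `0 * 0 + c` so that the
      -- bounds for adding a constant and for multiplying by one apply in turn.
      have hle : ∀ x, x ∈ D → ‖x - a‖ₑ ^ (-m) ≤ 0 * 0 + c := by
        intro x hx
        rw [mul_zero, zero_add, hc, ← ofReal_norm]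
        refine ENNReal.rpow_le_rpow (ENNReal.ofReal_le_ofReal ?_) (by linarith)
        simpa [dist_eq_norm] using hR hx
      refine (lorentzIntegral_mono (v := fun _ => 0 * 0 + c) subset_rfl hDf
        (Eventually.of_forall hle)).trans_lt ?_
      refine (lorentzIntegral_add_const (by positivity) c).trans_lt (ENNReal.add_lt_top.2 ⟨?_, ?_⟩)
      · exact (lorentzIntegral_const_mul ENNReal.zero_ne_top).trans_lt (by simp)
      · exact ENNReal.mul_lt_top ENNReal.ofReal_lt_top hcf.lt_top

end PowerFunction

/-! ### Sequences of vanishing norm and their local convergence. -/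

section Capacity

variable {Ω K : Set (EuclideanSpace ℝ (Fin n))} {V : EuclideanSpace ℝ (Fin n) → ℝ≥0∞}

theorem enorm_gradient (f : EuclideanSpace ℝ (Fin n) → ℝ) (x : EuclideanSpace ℝ (Fin n)) :
    ‖gradient f x‖ₑ = ‖fderiv ℝ f x‖ₑ := by
  rw [← ofReal_norm, ← ofReal_norm, gradient, LinearIsometryEquiv.norm_map]

theorem isOpen_awayFrom (hΩ : IsOpen Ω) : IsOpen (awayFrom Ω K) :=
  hΩ.inter (isOpen_lt continuous_const Metric.continuous_infEDist)

/-- Near-minimisers with norm below `1/(k+1)` converge to `0` in `L¹`, hence in measure, hence a.e.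
along a subsequence; the norms still tend to `0` along it. -/
theorem exists_seq_of_capacity_eq_zero (h : capacity Ω V K = 0) :
    ∃ ψ : ℕ → EuclideanSpace ℝ (Fin n) → ℝ, (∀ j, ψ j ∈ B2 Ω K) ∧
      (∀ j, potentialNorm Ω V (ψ j) < ∞) ∧
      Tendsto (fun j => potentialNorm Ω V (ψ j)) atTop (𝓝 0) ∧
      ∀ᵐ x ∂(volume.restrict Ω), Tendsto (fun j => ψ j x) atTop (𝓝 0) := by
  have hex : ∀ k : ℕ, ∃ ψ ∈ B2 Ω K, potentialNorm Ω V ψ < ((k : ℝ≥0∞) + 1)⁻¹ := by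
    intro k
    have hpos : capacity Ω V K < ((k : ℝ≥0∞) + 1)⁻¹ := by
      rw [h]; simp
    simpa only [capacity, iInf_lt_iff, exists_prop] using hpos
  choose χ hχB hχ using hex
  have hlim : Tendsto (fun j => potentialNorm Ω V (χ j)) atTop (𝓝 0) := by
    refine tendsto_of_tendsto_of_tendsto_of_le_of_le tendsto_const_nhds
      ?_ (fun _ => zero_le) fun j => (hχ j).le
    have := (ENNReal.tendsto_inv_nat_nhds_zero).comp (tendsto_add_atTop_nat 1)
    simpa [Function.comp_def] using this
  have hL1 : Tendsto (fun j => eLpNorm (χ j - 0) 1 (volume.restrict Ω)) atTop (𝓝 0) := by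
    refine tendsto_of_tendsto_of_tendsto_of_le_of_le tendsto_const_nhds hlim (fun _ => zero_le)
      fun j => ?_
    rw [sub_zero]
    exact (le_self_add.trans le_self_add)
  have hmeas := tendstoInMeasure_of_tendsto_eLpNorm one_ne_zero
    (fun j => (hχB j).1.1.continuous.aestronglyMeasurable)
    (aestronglyMeasurable_const (b := (0 : ℝ))) hL1
  obtain ⟨ns, hns, hae⟩ := hmeas.exists_seq_tendsto_ae
  refine ⟨fun j => χ (ns j), fun j => hχB _, fun j => (hχ _).trans_le ?_,
    hlim.comp hns.tendsto_atTop, hae⟩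
  exact le_top

theorem exists_tendsto_bound (hn : 2 ≤ n) (hΩ : IsOpen Ω)
    {ψ : ℕ → EuclideanSpace ℝ (Fin n) → ℝ} (hψ : ∀ j, ψ j ∈ B2 Ω K)
    (hfin : ∀ j, potentialNorm Ω V (ψ j) < ∞)
    (hlim : Tendsto (fun j => potentialNorm Ω V (ψ j)) atTop (𝓝 0))
    (hV : MemLorentzLoc ((n : ℝ) / 2) 1 (awayFrom Ω K) V)
    {ω : Set (EuclideanSpace ℝ (Fin n))} (hω : CompactlyContained ω (awayFrom Ω K)) :
    ∃ B : ℕ → ℝ≥0∞, Tendsto B atTop (𝓝 0) ∧ (∀ j, ∀ x ∈ closure ω, ‖ψ j x‖ₑ ≤ B j) ∧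
      ∀ j, lorentzIntegral (n : ℝ) ω (fun x => ‖gradient (ψ j) x‖ₑ) ≤ B j := by
  have hn0 : (0 : ℝ) < n := by positivity
  obtain ⟨C, hC, hest⟩ := exists_interior_estimate hn (isOpen_awayFrom hΩ) hω hV
  set N : ℕ → ℝ≥0∞ := fun j => potentialNorm Ω V (ψ j) with hN
  -- A vanishing positive perturbation of the norms: it makes the radius parameter `d` positive and
  -- `ε` nonzero, even if some norm is `0`.
  set δ : ℕ → ℝ := fun j => 1 / ((j : ℝ) + 1) with hδ
  have hδ0 : ∀ j, 0 < δ j := fun j => by positivity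
  have hδlim : Tendsto δ atTop (𝓝 0) := tendsto_one_div_add_atTop_nhds_zero_nat
  set ε : ℕ → ℝ≥0∞ := fun j => N j + ENNReal.ofReal (δ j) with hε
  set d : ℕ → ℝ := fun j => (N j).toReal + δ j with hd
  have hεlim : Tendsto ε atTop (𝓝 0) := by
    simpa using hlim.add (ENNReal.tendsto_ofReal hδlim)
  have hdlim : Tendsto (fun j => ENNReal.ofReal (d j ^ (1 / (n : ℝ)))) atTop (𝓝 0) := by
    have h1 : Tendsto d atTop (𝓝 0) := by
      simpa using ((ENNReal.tendsto_toReal ENNReal.zero_ne_top).comp hlim).add hδlim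
    have h2 := ENNReal.tendsto_ofReal (h1.rpow_const (p := 1 / (n : ℝ)) (.inr (by positivity)))
    rwa [Real.zero_rpow (by positivity), ENNReal.ofReal_zero] at h2
  -- Clearing the denominator is delicate at two values: where `W = 0` the ratio bound forces `f =
  -- 0` because `ε` is finite, and where `W = ∞` the product `ε W` is infinite because `ε` is
  -- nonzero.
  have hratio : ∀ {j : ℕ} {f W : EuclideanSpace ℝ (Fin n) → ℝ≥0∞},
      essSup (fun x => f x / W x) (volume.restrict Ω) ≤ N j →
      ∀ᵐ y ∂volume, y ∈ awayFrom Ω K → f y ≤ ε j * W y := by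
    intro j f W hle
    have hεf : ε j ≠ ∞ := ENNReal.add_ne_top.2 ⟨(hfin j).ne, ENNReal.ofReal_ne_top⟩
    have hε0 : ε j ≠ 0 := by
      rw [hε]
      simp [hδ0 j]
    have := (ae_restrict_iff' hΩ.measurableSet).1
      (ENNReal.ae_le_essSup (μ := volume.restrict Ω) (fun x => f x / W x))
    filter_upwards [this] with y hy hyO
    exact (ENNReal.div_le_iff_le_mul (.inr hεf) (.inr hε0)).1
      ((hy hyO.1).trans (hle.trans le_self_add))
  refine ⟨fun j => C * (ε j + ENNReal.ofReal (d j ^ (1 / (n : ℝ)))), ?_, ?_⟩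
  · simpa using ENNReal.Tendsto.const_mul (hεlim.add hdlim) (.inr hC)
  have key : ∀ j, _ := fun j => hest (ψ j) (hψ j).1.1 (hψ j).2.1 (ε j) (d j)
    (ENNReal.add_ne_top.2 ⟨(hfin j).ne, ENNReal.ofReal_ne_top⟩)
    (add_pos_of_nonneg_of_pos ENNReal.toReal_nonneg (hδ0 j))
    (by
      simp_rw [← enorm_gradient]
      exact hratio (le_add_self.trans le_self_add))
    (hratio le_add_self)
    (by
      calc ∫⁻ y in awayFrom Ω K, ‖ψ j y‖ₑ ≤ ∫⁻ y in Ω, ‖ψ j y‖ₑ :=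
            lintegral_mono_set fun y hy => hy.1
        _ = eLpNorm (ψ j) 1 (volume.restrict Ω) := eLpNorm_one_eq_lintegral_enorm.symm
        _ ≤ N j := le_self_add.trans le_self_add
        _ = ENNReal.ofReal (N j).toReal := (ENNReal.ofReal_toReal (hfin j).ne).symm
        _ ≤ _ := ENNReal.ofReal_le_ofReal (le_add_of_nonneg_right (hδ0 j).le))
  refine ⟨fun j => (key j).1, fun j => ?_⟩
  simp_rw [enorm_gradient]
  exact (key j).2

theorem exists_compactlyContained_mem {O : Set (EuclideanSpace ℝ (Fin n))} (hO : IsOpen O)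
    {x : EuclideanSpace ℝ (Fin n)} (hx : x ∈ O) : ∃ ω, CompactlyContained ω O ∧ x ∈ ω := by
  obtain ⟨ω, h1, h2, h3, h4⟩ := exists_open_between_and_isCompact_closure isCompact_singleton hO
    (singleton_subset_iff.2 hx)
  exact ⟨ω, ⟨h1, h4, h3⟩, h2 rfl⟩

end Capacity

end PotentialCapacity

end

theorem theorem1 (n : ℕ) (hn : 2 ≤ n) (Ω : Set (EuclideanSpace ℝ (Fin n)))
    (hΩo : IsOpen Ω) (hΩb : Bornology.IsBounded Ω) :
    (∀ V : EuclideanSpace ℝ (Fin n) → ℝ≥0∞, AEMeasurable V (volume.restrict Ω) →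
      ∀ K : Set (EuclideanSpace ℝ (Fin n)), IsCompact K → K ⊆ Ω →
        PotentialCapacity.capacity Ω V K = 0 →
        ∃ ψ : ℕ → EuclideanSpace ℝ (Fin n) → ℝ,
          (∀ j, ψ j ∈ PotentialCapacity.C2c Ω) ∧
          ((∀ j, ∀ x ∈ K, ψ j x = 1) ∧
            (∀ᵐ x ∂(volume.restrict Ω), Tendsto (fun j => ψ j x) atTop (𝓝 0)) ∧
            Tendsto (fun j => eLpNorm (ψ j) 1 (volume.restrict Ω)) atTop (𝓝 0) ∧
            ((∀ j, PotentialCapacity.gradRatioNorm Ω V (ψ j) < ∞) ∧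
              Tendsto (fun j => PotentialCapacity.gradRatioNorm Ω V (ψ j)) atTop (𝓝 0)) ∧
            ((∀ j, PotentialCapacity.laplaceRatioNorm Ω V (ψ j) < ∞) ∧
              Tendsto (fun j => PotentialCapacity.laplaceRatioNorm Ω V (ψ j)) atTop (𝓝 0))) ∧
          (PotentialCapacity.MemLorentzLoc ((n : ℝ) / 2) 1 (PotentialCapacity.awayFrom Ω K) V →
            (∀ x ∈ Ω \ K, Tendsto (fun j => ψ j x) atTop (𝓝 0)) ∧
            ∀ ω, PotentialCapacity.CompactlyContained ω (PotentialCapacity.awayFrom Ω K) →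
              Tendsto (fun j => ⨆ x ∈ closure ω, ‖ψ j x‖ₑ) atTop (𝓝 0) ∧
              Tendsto (fun j => PotentialCapacity.lorentzNorm (n : ℝ) 1 ω
                (fun x => ‖gradient (ψ j) x‖ₑ)) atTop (𝓝 0))) ∧
    (∀ a ∈ Ω, ∀ m : ℝ,
      PotentialCapacity.MemLorentz ((n : ℝ) / 2) 1 Ω (fun x => ‖x - a‖ₑ ^ (-m)) ↔ m < 2) := by
  refine ⟨fun V _ K hK _ hcap => ?_,
    fun a ha m => PotentialCapacity.memLorentz_norm_rpow_iff hn hΩo hΩb ha m⟩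
  obtain ⟨ψ, hψ, hfin, hlim, hae⟩ := PotentialCapacity.exists_seq_of_capacity_eq_zero hcap
  have hle₁ : ∀ j, eLpNorm (ψ j) 1 (volume.restrict Ω) ≤ PotentialCapacity.potentialNorm Ω V (ψ j) :=
    fun j => le_self_add.trans le_self_add
  have hle₂ : ∀ j, PotentialCapacity.gradRatioNorm Ω V (ψ j) ≤
      PotentialCapacity.potentialNorm Ω V (ψ j) := fun j => le_add_self.trans le_self_add
  have hle₃ : ∀ j, PotentialCapacity.laplaceRatioNorm Ω V (ψ j) ≤
      PotentialCapacity.potentialNorm Ω V (ψ j) := fun j => le_add_self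
  have hsq : ∀ {f : ℕ → ℝ≥0∞}, (∀ j, f j ≤ PotentialCapacity.potentialNorm Ω V (ψ j)) →
      Tendsto f atTop (𝓝 0) := fun hf =>
    tendsto_of_tendsto_of_tendsto_of_le_of_le tendsto_const_nhds hlim (fun _ => zero_le) hf
  refine ⟨ψ, fun j => (hψ j).1, ⟨fun j x hx => (hψ j).2.2.self_of_nhdsSet x hx, hae, hsq hle₁,
    ⟨fun j => (hle₂ j).trans_lt (hfin j), hsq hle₂⟩,
    ⟨fun j => (hle₃ j).trans_lt (hfin j), hsq hle₃⟩⟩, fun hV => ⟨fun x hx => ?_, fun ω hω => ?_⟩⟩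
  · have hxO : x ∈ PotentialCapacity.awayFrom Ω K := by
      refine ⟨hx.1, Metric.infEDist_pos_iff_notMem_closure.2 ?_⟩
      rw [hK.isClosed.closure_eq]
      exact hx.2
    obtain ⟨ω, hω, hxω⟩ := PotentialCapacity.exists_compactlyContained_mem
      (PotentialCapacity.isOpen_awayFrom hΩo) hxO
    obtain ⟨B, hB, hsup, -⟩ :=
      PotentialCapacity.exists_tendsto_bound hn hΩo hψ hfin hlim hV hω
    rw [tendsto_zero_iff_enorm_tendsto_zero]
    exact tendsto_of_tendsto_of_tendsto_of_le_of_le tendsto_const_nhds hB (fun _ => zero_le)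
      fun j => hsup j x (subset_closure hxω)
  · obtain ⟨B, hB, hsup, hgrad⟩ :=
      PotentialCapacity.exists_tendsto_bound hn hΩo hψ hfin hlim hV hω
    have hωf : volume ω ≠ ∞ := ((measure_mono subset_closure).trans_lt hω.2.1.measure_lt_top).ne
    refine ⟨tendsto_of_tendsto_of_tendsto_of_le_of_le tendsto_const_nhds hB (fun _ => zero_le)
      fun j => iSup₂_le (hsup j), ?_⟩
    simp_rw [PotentialCapacity.lorentzNorm_one_eq hωf]
    rcases eq_or_ne (volume ω) 0 with h0 | h0
    · simp [PotentialCapacity.lorentzIntegral, h0]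
    · have h1 : Tendsto (fun j => (volume ω)⁻¹ * B j) atTop (𝓝 0) := by
        simpa using ENNReal.Tendsto.const_mul hB (.inr (ENNReal.inv_ne_top.2 h0))
      exact tendsto_of_tendsto_of_tendsto_of_le_of_le tendsto_const_nhds h1 (fun _ => zero_le)
        fun j => mul_le_mul_right (hgrad j) _
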